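/- Let $S=(S_t)_{t\in\mathbb R}$ be a two-sided subordinator, i.e. $S_t=-S^{(1)}_{(-t)-}\mathbf 1_{\{t<0\}}+S^{(2)}_t\mathbf 1_{\{t\ge0\}}$ for two independent, identically distributed subordinators $S^{(1)},S^{(2)}$ (Lévy processes on $[0,\infty)$ with a.s. nondecreasing right-continuous paths), and suppose $\mathbb E(S_1^2)<\infty$. Let $d\in(-\tfrac12,0)$, $a>0$, and for $t\in\mathbb R$ put $$f_{a,d}(t,s)=\bigl(a+(-s)_+\bigr)^d-\bigl(a+(t-s)_+\bigr)^d,\qquad s\in\mathbb R,$$ $$S^{a,d}_t=\int_{\mathbb R} f_{a,d}(t,u)\,dS_u ,$$ where the integral is the $L^2(\Omega)$-limit of the elementary integrals $\sum_i c_i(S_{v_i}-S_{u_i})$ of step functions $\sum_i c_i\mathbf 1_{(u_i,v_i]}$ converging to $f_{a,d}(t,\cdot)$ in $L^1(\mathbb R)$ and in $L^2(\mathbb R)$. These integrals exist and are unique up to null sets for each $t\in\mathbb R$. The process $S^{a,d}$, being determined for each $t$ only up to a null set, has a modification (again denoted by $S^{a,d}$) with the following properties. (i) $(S^{a,d}_t)_{t\ge0}$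 has a.s. continuous sample paths of finite variation on compact intervals. (ii) With respect to the filtration $(\mathcal F_t)_{t\ge0}$ generated by $S$ (where $\mathcal F_t$ is generated by $\{S_u: u\le t\}$, $u$ real, and the null sets), $(S^{a,d}_t)_{t\ge0}$ is a semimartingale with characteristics $(S^{a,d},0,0)$, for every choice of truncation function. (iii) If $S$ has a.s. strictly increasing sample paths, or if $S_1$ has characteristic triple $(\gamma_S,0,\nu_S)$ (drift $\gamma_S\ge 0$, no Gaussian part, Lévy measure $\nu_S$, that is, $\mathbb E e^{-\lambda S_1}=\exp\{-\gamma_S\lambda-\int_{(0,\infty)}(1-e^{-\lambda x})\,\nu_S(dx)\}$ for all $\lambda\ge0$) with $\gamma_S>0$ or $\nu_S((0,\infty))=\infty$, then $(S^{a,d}_t)_{t\ge0}$ has a.s. strictly increasing sample paths. -/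

import Mathlib

open MeasureTheory ProbabilityTheory Filter Topology Set
open scoped NNReal ENNReal

noncomputable section

/-! ### Subordinators -/

/-- A (one-sided, real-valued) subordinator: a Lévy process whose paths are almost surely
right-continuous and nondecreasing (left limits are then automatic). -/
structure IsSubordinator {Ω : Type*} [MeasurableSpace Ω] (P : Measure Ω)
    (L : ℝ≥0 → Ω → ℝ) : Prop where
  measurable : ∀ t, Measurable (L t)
  zero : ∀ᵐ ω ∂P, L 0 ω = 0
  indep_increments : HasIndepIncrements L P
  stationary_increments : ∀ s t, IdentDistrib (fun ω => L (s + t) ω - L s ω) (L t) P P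
  monotone : ∀ᵐ ω ∂P, Monotone fun t => L t ω
  rightCts : ∀ᵐ ω ∂P, ∀ t, ContinuousWithinAt (fun s => L s ω) (Ici t) t

/-- A two-sided subordinator: `S t = - L₁ ((-t)-)` for `t < 0` and `S t = L₂ t` for `t ≥ 0`,
where `L₁`, `L₂` are independent, identically distributed subordinators. -/
structure IsTwoSidedSubordinator {Ω : Type*} [MeasurableSpace Ω] (P : Measure Ω)
    (S : ℝ → Ω → ℝ) : Prop where
  measurable : ∀ t, Measurable (S t)
  exists_copies : ∃ L₁ L₂ : ℝ≥0 → Ω → ℝ, IsSubordinator P L₁ ∧ IsSubordinator P L₂ ∧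
    IndepFun (fun ω t => L₁ t ω) (fun ω t => L₂ t ω) P ∧
    IdentDistrib (fun ω t => L₁ t ω) (fun ω t => L₂ t ω) P P ∧
    ∀ᵐ ω ∂P, ∀ t : ℝ, S t ω =
      if t < 0 then - Function.leftLim (fun s => L₁ s ω) (-t).toNNReal else L₂ t.toNNReal ω

/-- `(γ, 0, ν)` is the characteristic triple of a subordinator whose value at time one has
law `μ`: `γ ≥ 0` is the drift, `ν` the Lévy measure (carried by `(0, ∞)`, with
`∫ min(1, x) ν(dx) < ∞`), and
`∫ e^{-l x} μ(dx) = exp (-(γ l + ∫ (1 - e^{-l x}) ν(dx)))` for all `l ≥ 0`. -/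
structure IsSubordinatorTriple (μ : Measure ℝ) (γ : ℝ) (ν : Measure ℝ) : Prop where
  drift_nonneg : 0 ≤ γ
  carried : ν (Iic 0) = 0
  integrable_min : ∫⁻ x, ENNReal.ofReal (min 1 x) ∂ν < ∞
  laplace : ∀ l : ℝ, 0 ≤ l →
    ∫ x, Real.exp (-(l * x)) ∂μ = Real.exp (-(γ * l + ∫ x, (1 - Real.exp (-(l * x))) ∂ν))

/-! ### Integrals of deterministic kernels and the fractional subordinator -/

/-- Data of a step function `∑ i, coeff i • 1_{(left i, right i]}` on the real line. -/
structure StepFunction where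
  n : ℕ
  coeff : Fin n → ℝ
  left : Fin n → ℝ
  right : Fin n → ℝ
  left_le_right : ∀ i, left i ≤ right i

namespace StepFunction

/-- The function represented by the step function data. -/
def toFun (φ : StepFunction) (x : ℝ) : ℝ :=
  ∑ i, (Ioc (φ.left i) (φ.right i)).indicator (fun _ => φ.coeff i) x

/-- The elementary integral `∑ i, coeff i * (S (right i) - S (left i))`. -/
def integral {Ω : Type*} (φ : StepFunction) (S : ℝ → Ω → ℝ) (ω : Ω) : ℝ :=
  ∑ i, φ.coeff i * (S (φ.right i) ω - S (φ.left i) ω)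

end StepFunction

/-- The random variable `I` is (a version of) the stochastic integral `∫ f(u) dS_u` of the
deterministic kernel `f` over the real line: it is square integrable, and for some step functions
approximating `f` in `L¹(ℝ)` and in `L²(ℝ)` the elementary integrals converge to `I` in `L²(Ω)`
(hence in probability). -/
def IsKernelIntegral {Ω : Type*} [MeasurableSpace Ω] (P : Measure Ω) (S : ℝ → Ω → ℝ)
    (f : ℝ → ℝ) (I : Ω → ℝ) : Prop :=
  MemLp I 2 P ∧ ∃ φ : ℕ → StepFunction,
    Tendsto (fun n => eLpNorm (fun x => (φ n).toFun x - f x) 1 volume) atTop (𝓝 0) ∧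
    Tendsto (fun n => eLpNorm (fun x => (φ n).toFun x - f x) 2 volume) atTop (𝓝 0) ∧
    Tendsto (fun n => eLpNorm (fun ω => (φ n).integral S ω - I ω) 2 P) atTop (𝓝 0)

/-- The non-normalized modified Mandelbrot-van-Ness kernel
`f_{a,d}(t, s) = (a + (-s)₊)^d - (a + (t - s)₊)^d`. -/
def modMvNKernel (a d t s : ℝ) : ℝ :=
  (a + max (-s) 0) ^ d - (a + max (t - s) 0) ^ d

/-- `X` is (a version of) the fractional subordinator `S^{a,d}`: for every real `t`,
`X t` is a version of `∫ f_{a,d}(t, u) dS_u`. -/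
def IsFractionalSubordinator {Ω : Type*} [MeasurableSpace Ω] (P : Measure Ω) (S : ℝ → Ω → ℝ)
    (a d : ℝ) (X : ℝ → Ω → ℝ) : Prop :=
  ∀ t : ℝ, IsKernelIntegral P S (modMvNKernel a d t) (X t)

/-- The filtration `(𝓕_t)_{t ≥ 0}` generated by `S`: `𝓕_t` is generated by all `S u` with
`u ≤ t` (including negative `u`) and, as usual, the `P`-null sets. -/
def generatedFiltration {Ω : Type*} [mΩ : MeasurableSpace Ω] (P : Measure Ω) (S : ℝ → Ω → ℝ)
    (hS : ∀ t, Measurable (S t)) : Filtration ℝ≥0 mΩ where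
  seq t := (⨆ u : Iic (t : ℝ), MeasurableSpace.comap (S u) inferInstance) ⊔
    MeasurableSpace.generateFrom {N | MeasurableSet N ∧ P N = 0}
  mono' := by
    intro s t hst
    refine sup_le_sup_right (iSup_le fun u => ?_) _
    exact le_iSup (fun u : Iic (t : ℝ) => MeasurableSpace.comap (S u) inferInstance)
      ⟨u.1, le_trans u.2 (NNReal.coe_le_coe.2 hst)⟩
  le' := by
    intro t
    refine sup_le (iSup_le fun u => (hS u).comap_le) (MeasurableSpace.generateFrom_le ?_)
    exact fun N hN => hN.1

/-! ### Semimartingales and their characteristics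

Processes are indexed by `ℝ≥0` and real-valued. -/

/-- A right-continuous function with left limits. -/
def IsCadlagPath (x : ℝ≥0 → ℝ) : Prop :=
  ∀ t, ContinuousWithinAt x (Ici t) t ∧ ∃ l, Tendsto x (𝓝[<] t) (𝓝 l)

/-- The jump `Δx_t = x_t - x_{t-}` (with `x_{0-} = x_0`). -/
def pathJump (x : ℝ≥0 → ℝ) (t : ℝ≥0) : ℝ := x t - Function.leftLim x t

section Semimartingale

variable {Ω : Type*} [mΩ : MeasurableSpace Ω]

/-- A càdlàg local martingale null at time zero. -/
structure IsLocalMartingaleNull (𝓕 : Filtration ℝ≥0 mΩ) (P : Measure Ω)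
    (M : ℝ≥0 → Ω → ℝ) : Prop where
  null : ∀ ω, M 0 ω = 0
  adapted : StronglyAdapted 𝓕 M
  cadlag : ∀ ω, IsCadlagPath fun t => M t ω
  locally_martingale : Locally (fun N => Martingale N 𝓕 P) 𝓕 M P

/-- A càdlàg adapted process, null at time zero, whose paths have finite variation on compacts. -/
structure IsFiniteVariationNull (𝓕 : Filtration ℝ≥0 mΩ) (A : ℝ≥0 → Ω → ℝ) : Prop where
  null : ∀ ω, A 0 ω = 0
  adapted : StronglyAdapted 𝓕 A
  cadlag : ∀ ω, IsCadlagPath fun t => A t ω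
  variation : ∀ ω, LocallyBoundedVariationOn (fun t => A t ω) univ

/-- A semimartingale: an adapted càdlàg process of the form `X = X₀ + M + A`. -/
structure IsSemimartingale (𝓕 : Filtration ℝ≥0 mΩ) (P : Measure Ω)
    (X : ℝ≥0 → Ω → ℝ) : Prop where
  adapted : StronglyAdapted 𝓕 X
  cadlag : ∀ ω, IsCadlagPath fun t => X t ω
  decomposition : ∃ M A : ℝ≥0 → Ω → ℝ, IsLocalMartingaleNull 𝓕 P M ∧
    IsFiniteVariationNull 𝓕 A ∧ ∀ t ω, X t ω = X 0 ω + M t ω + A t ω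

/-- A purely discontinuous local martingale (null at zero): one that is orthogonal to every
continuous local martingale null at zero. -/
def IsPurelyDiscontinuous (𝓕 : Filtration ℝ≥0 mΩ) (P : Measure Ω)
    (D : ℝ≥0 → Ω → ℝ) : Prop :=
  IsLocalMartingaleNull 𝓕 P D ∧ ∀ N : ℝ≥0 → Ω → ℝ, IsLocalMartingaleNull 𝓕 P N →
    (∀ ω, Continuous fun t => N t ω) → IsLocalMartingaleNull 𝓕 P fun t ω => D t ω * N t ω

/-- `N` is the continuous martingale part `X^c` of the semimartingale `X`. -/
def IsContinuousMartingalePart (𝓕 : Filtration ℝ≥0 mΩ) (P : Measure Ω)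
    (X N : ℝ≥0 → Ω → ℝ) : Prop :=
  IsLocalMartingaleNull 𝓕 P N ∧ (∀ ω, Continuous fun t => N t ω) ∧
    ∃ D A : ℝ≥0 → Ω → ℝ, IsPurelyDiscontinuous 𝓕 P D ∧ IsFiniteVariationNull 𝓕 A ∧
      ∀ t ω, X t ω = X 0 ω + N t ω + D t ω + A t ω

/-- A truncation function: bounded, Borel, compactly supported, the identity near zero. -/
structure IsTruncation (h : ℝ → ℝ) : Prop where
  measurable : Measurable h
  bounded : ∃ K, ∀ x, |h x| ≤ K
  compact : HasCompactSupport h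
  id_near_zero : ∀ᶠ x in 𝓝 0, h x = x

/-- The sum `∑_{s ≤ t} (ΔX_s - h(ΔX_s))` of the large jumps. -/
def largeJumps (h : ℝ → ℝ) (X : ℝ≥0 → Ω → ℝ) (t : ℝ≥0) (ω : Ω) : ℝ :=
  ∑ᶠ s ∈ Iic t, (pathJump (fun r => X r ω) s - h (pathJump (fun r => X r ω) s))

/-- The jump measure `μ^X = ∑_s 1_{ΔX_s ≠ 0} δ_{(s, ΔX_s)}`. -/
def jumpMeasure (X : ℝ≥0 → Ω → ℝ) (ω : Ω) : Measure (ℝ≥0 × ℝ) :=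
  Measure.sum fun s : {s : ℝ≥0 // pathJump (fun r => X r ω) s ≠ 0} =>
    Measure.dirac ((s : ℝ≥0), pathJump (fun r => X r ω) s)

/-- Nonnegative predictable functions on `(ℝ₊ × Ω) × ℝ`: measurable for the product of the
predictable and the Borel σ-algebras. -/
def IsPredictableFunction (𝓕 : Filtration ℝ≥0 mΩ) (W : (ℝ≥0 × Ω) × ℝ → ℝ≥0∞) : Prop :=
  Measurable[MeasurableSpace.prod 𝓕.predictable inferInstance] W

/-- `ν` is the predictable compensator of the jump measure of `X`. -/
structure IsJumpCompensator (𝓕 : Filtration ℝ≥0 mΩ) (P : Measure Ω) (X : ℝ≥0 → Ω → ℝ)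
    (ν : Ω → Measure (ℝ≥0 × ℝ)) : Prop where
  null_at_zero : ∀ ω, ν ω ({0} ×ˢ univ) = 0
  predictable : ∀ W, IsPredictableFunction 𝓕 W → Measurable[𝓕.predictable]
    fun p : ℝ≥0 × Ω => ∫⁻ z in Iic p.1 ×ˢ univ, W ((z.1, p.2), z.2) ∂(ν p.2)
  compensates : ∀ W, IsPredictableFunction 𝓕 W →
    ∫⁻ ω, ∫⁻ z, W ((z.1, ω), z.2) ∂(ν ω) ∂P =
      ∫⁻ ω, ∫⁻ z, W ((z.1, ω), z.2) ∂(jumpMeasure X ω) ∂P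

/-- `X` is a semimartingale and `(B, C, ν)` are its characteristics relative to the truncation
function `h`. -/
structure HasCharacteristics (𝓕 : Filtration ℝ≥0 mΩ) (P : Measure Ω) (h : ℝ → ℝ)
    (X B C : ℝ≥0 → Ω → ℝ) (ν : Ω → Measure (ℝ≥0 × ℝ)) : Prop where
  semimartingale : IsSemimartingale 𝓕 P X
  first_predictable : IsStronglyPredictable 𝓕 B
  first_finiteVariation : IsFiniteVariationNull 𝓕 B
  first : IsLocalMartingaleNull 𝓕 P
    fun t ω => X t ω - X 0 ω - largeJumps h X t ω - B t ω
  second_null : ∀ ω, C 0 ω = 0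
  second_adapted : StronglyAdapted 𝓕 C
  second_continuous : ∀ ω, Continuous fun t => C t ω
  second_monotone : ∀ ω, Monotone fun t => C t ω
  second : ∃ N : ℝ≥0 → Ω → ℝ, IsContinuousMartingalePart 𝓕 P X N ∧
    IsLocalMartingaleNull 𝓕 P fun t ω => N t ω ^ 2 - C t ω
  third : IsJumpCompensator 𝓕 P X ν

end Semimartingale

end

noncomputable section

/-! For `s ≤ t` the function `(a + (s - x)₊)^d - (a + (t - x)₊)^d` is a positive mixture of
indicators of intervals `(r - w, r]`, with `r` uniform on `(s, t]` and `w > 0` weighted by `d (d -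
1) (w + a)^(d - 2) dw` (`overlap_lagIntervals`). Exchanging integrals suggests that `S^{a,d}_t` is
`∫_0^t D_r dr` with the nonnegative density `D_r = ∫ (S_r - S_{r-w}) d (d - 1) (w + a)^(d - 2) dw`,
computed path by path; this is `fractionalPath`. Once this process is shown to be the stochastic
integral, its paths are visibly continuous and nondecreasing.

The identification is an isometry. A two-sided subordinator with `m = E S_1`, `v = Var S_1`
satisfies `E[S(I) S(J)] = v |I ∩ J| + m² |I| |J|` for the increments over intervals `I`, `J`.
Everything is nonnegative, so Tonelli extends this to mixtures of intervals
(`HasLinearMoments.lintegral_incrementIntegral_mul`). The squared `L²(Ω)` distance between an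
elementary integral and the pathwise integral is therefore `v ‖φ - f‖₂² + m² (∫ (φ - f))²`, which
vanishes in the limit when `φ → f` in `L¹` and `L²`. This gives existence and uniqueness together.

The process starts at zero, is adapted (`measurable_fractionalPath_of_le`), continuous and of finite
variation. Its local martingale part may be taken to be zero and it has no jumps, whence the
characteristics. It increases strictly on `[0, ∞)` as soon as `S_u < S_0` for some `u`, because then
`D_r > 0` for all `r ≥ 0`; when `m > 0` such a `u` exists almost surely by Chebyshev's inequality.
-/

theorem eq_mul_of_additive_of_nonneg {f : ℝ≥0 → ℝ} (h0 : ∀ t, 0 ≤ f t)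
    (hadd : ∀ s t, f (s + t) = f s + f t) (t : ℝ≥0) : f t = t * f 1 := by
  have hmono : Monotone f := by
    intro s t hst
    obtain ⟨u, rfl⟩ := exists_add_of_le hst
    rw [hadd]; linarith [h0 u]
  have hz : f 0 = 0 := by have := hadd 0 0; simp at this; exact this
  have hn : ∀ (n : ℕ) (t : ℝ≥0), f (n * t) = n * f t := by
    intro n t
    induction n with
    | zero => simp [hz]
    | succ n ih => rw [Nat.cast_succ, add_mul, hadd, ih, one_mul]; push_cast; ring
  -- Both `n * f t` and `n * t * f 1` lie between `⌊n * t⌋₊ * f 1` and `(⌊n * t⌋₊ + 1) * f 1`, and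
  -- this gap does not grow with `n`.
  have key : ∀ n : ℕ, n * |f t - t * f 1| ≤ f 1 := by
    intro n
    have h1 : (⌊n * t⌋₊ : ℝ≥0) ≤ n * t := Nat.floor_le (by positivity)
    have h2 : n * t ≤ (⌊n * t⌋₊ + 1 : ℕ) := by
      have := (Nat.lt_floor_add_one (n * t)).le
      exact_mod_cast this
    have e1 := hmono h1
    have e2 := hmono h2
    have e3 := hn ⌊n * t⌋₊ 1
    have e4 := hn (⌊n * t⌋₊ + 1) 1
    rw [mul_one] at e3 e4
    rw [e3, hn] at e1
    rw [e4, hn] at e2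
    push_cast at e2
    have h1' : (⌊n * t⌋₊ : ℝ) ≤ n * t := by exact_mod_cast h1
    have h2' : (n : ℝ) * t ≤ ⌊n * t⌋₊ + 1 := by exact_mod_cast h2
    have h11 := h0 1
    rw [← abs_of_nonneg (Nat.cast_nonneg n : (0 : ℝ) ≤ n), ← abs_mul, abs_le]
    constructor <;> nlinarith
  by_contra hne
  have hpos : 0 < |f t - t * f 1| := abs_pos.2 (sub_ne_zero.2 hne)
  obtain ⟨n, hn⟩ := exists_nat_gt (f 1 / |f t - t * f 1|)
  rw [div_lt_iff₀ hpos] at hn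
  linarith [key n]

/-! ### Moments of one-sided subordinators -/

namespace IsSubordinator

variable {Ω : Type*} [MeasurableSpace Ω] {P : Measure Ω} [IsProbabilityMeasure P]
  {L : ℝ≥0 → Ω → ℝ}

omit [IsProbabilityMeasure P] in
theorem ae_nonneg (hL : IsSubordinator P L) : ∀ᵐ ω ∂P, ∀ t, 0 ≤ L t ω := by
  filter_upwards [hL.zero, hL.monotone] with ω h0 hm t
  simpa [h0] using hm (zero_le (a := t))

omit [IsProbabilityMeasure P] in
theorem memLp (hL : IsSubordinator P L) (h1 : MemLp (L 1) 2 P) (t : ℝ≥0) : MemLp (L t) 2 P := by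
  have hn : ∀ n : ℕ, MemLp (L n) 2 P := by
    intro n
    induction n with
    | zero =>
      refine (memLp_congr_ae ?_).2 (MemLp.zero (ε := ℝ))
      filter_upwards [hL.zero] with ω h; simpa using h
    | succ n ih =>
      have h2 : MemLp (fun ω => L (n + 1) ω - L n ω) 2 P :=
        ((hL.stationary_increments n 1).memLp_iff).2 h1
      have := h2.add ih
      refine (memLp_congr_ae (ae_of_all _ fun ω => ?_)).1 this
      simp
  obtain ⟨n, hn'⟩ := exists_nat_ge t
  refine (hn n).mono (hL.measurable t).aestronglyMeasurable ?_
  filter_upwards [hL.ae_nonneg, hL.monotone] with ω h0 hm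
  rw [Real.norm_of_nonneg (h0 _), Real.norm_of_nonneg (h0 _)]
  exact hm hn'

theorem integral_eq (hL : IsSubordinator P L) (h1 : MemLp (L 1) 2 P) (t : ℝ≥0) :
    ∫ ω, L t ω ∂P = t * ∫ ω, L 1 ω ∂P := by
  have hi : ∀ t, Integrable (L t) P := fun t => (hL.memLp h1 t).integrable (by norm_num)
  refine eq_mul_of_additive_of_nonneg (f := fun t => ∫ ω, L t ω ∂P) (fun t => ?_)
    (fun s t => ?_) t
  · exact integral_nonneg_of_ae (hL.ae_nonneg.mono fun ω h => h t)
  · have := (hL.stationary_increments s t).integral_eq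
    rw [integral_sub (hi _) (hi _)] at this
    linarith

omit [IsProbabilityMeasure P] in
theorem variance_eq (hL : IsSubordinator P L) (h1 : MemLp (L 1) 2 P) (t : ℝ≥0) :
    Var[L t; P] = t * Var[L 1; P] := by
  refine eq_mul_of_additive_of_nonneg (f := fun t => Var[L t; P]) (fun t => variance_nonneg _ _)
    (fun s t => ?_) t
  have hind : IndepFun (L s) (L (s + t) - L s) P :=
    hL.indep_increments.indepFun_eval_sub zero_le (by simp) hL.zero
  have := hind.variance_add (hL.memLp h1 s) ((hL.memLp h1 _).sub (hL.memLp h1 s))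
  rw [add_sub_cancel] at this
  rw [this]
  congr 1
  exact (hL.stationary_increments s t).variance_eq

theorem covariance_eq (hL : IsSubordinator P L) (h1 : MemLp (L 1) 2 P) (s t : ℝ≥0) :
    cov[L s, L t; P] = min s t * Var[L 1; P] := by
  wlog hst : s ≤ t generalizing s t
  · rw [covariance_comm, this t s (le_of_not_ge hst), min_comm]
  have hind : IndepFun (L s) (L t - L s) P :=
    hL.indep_increments.indepFun_eval_sub zero_le hst hL.zero
  have hm := (hL.memLp h1 t).sub (hL.memLp h1 s)
  have h2 := hind.covariance_eq_zero (hL.memLp h1 s) hm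
  rw [covariance_sub_right (hL.memLp h1 s) (hL.memLp h1 t) (hL.memLp h1 s),
    covariance_self (hL.measurable s).aemeasurable] at h2
  rw [min_eq_left hst, ← hL.variance_eq h1]
  linarith

/-- There are no fixed jump times: the jump at `t` is nonnegative and its mean is at most `E (L t -
L (u n)) = (t - u n) E (L 1)`, which tends to zero as `u n` increases to `t`. -/
theorem leftLim_ae_eq (hL : IsSubordinator P L) (h1 : MemLp (L 1) 2 P) (t : ℝ≥0) :
    ∀ᵐ ω ∂P, Function.leftLim (fun s => L s ω) t = L t ω := by
  rcases eq_or_ne t 0 with rfl | ht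
  · refine ae_of_all _ fun ω => leftLim_eq_of_isBot isBot_bot
  have hi : ∀ t, Integrable (L t) P := fun t => (hL.memLp h1 t).integrable (by norm_num)
  obtain ⟨u, hu, hut, hlim⟩ := exists_seq_strictMono_tendsto' (pos_iff_ne_zero.2 ht)
  have hz : ∀ᵐ ω ∂P, Tendsto (fun n => L (u n) ω) atTop
      (𝓝 (Function.leftLim (fun s => L s ω) t)) := by
    filter_upwards [hL.monotone] with ω hm
    refine (hm.tendsto_leftLim t).comp ?_
    exact tendsto_nhdsWithin_iff.2 ⟨hlim, Eventually.of_forall fun n => (hut n).2⟩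
  have hmono : ∀ᵐ ω ∂P, ∀ n, L (u n) ω ≤ Function.leftLim (fun s => L s ω) t ∧
      Function.leftLim (fun s => L s ω) t ≤ L t ω := by
    filter_upwards [hL.monotone] with ω hm n
    exact ⟨hm.le_leftLim (hut n).2, hm.leftLim_le le_rfl⟩
  have hmeas : AEStronglyMeasurable (fun ω => Function.leftLim (fun s => L s ω) t) P :=
    aestronglyMeasurable_of_tendsto_ae atTop
      (fun n => (hL.measurable (u n)).aestronglyMeasurable) hz
  have hint : Integrable (fun ω => Function.leftLim (fun s => L s ω) t) P := by
    refine (hi t).mono hmeas ?_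
    filter_upwards [hL.ae_nonneg, hmono] with ω h0 h
    rw [Real.norm_of_nonneg (h0 _), Real.norm_of_nonneg ((h0 _).trans (h 0).1)]
    exact (h 0).2
  have hle : ∫ ω, (L t ω - Function.leftLim (fun s => L s ω) t) ∂P ≤ 0 := by
    have hbd : ∀ n, ∫ ω, (L t ω - Function.leftLim (fun s => L s ω) t) ∂P ≤
        (t - u n) * ∫ ω, L 1 ω ∂P := by
      intro n
      have : (t - u n : ℝ) * ∫ ω, L 1 ω ∂P = ∫ ω, (L t ω - L (u n) ω) ∂P := by
        rw [integral_sub (hi _) (hi _), hL.integral_eq h1 t, hL.integral_eq h1 (u n)]; ring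
      rw [this]
      refine integral_mono_ae ((hi t).sub hint) ((hi t).sub (hi _)) ?_
      filter_upwards [hmono] with ω h
      linarith [(h n).1]
    have hl : Tendsto (fun n => (t - u n : ℝ) * ∫ ω, L 1 ω ∂P) atTop (𝓝 0) := by
      have : Tendsto (fun n => (u n : ℝ)) atTop (𝓝 t) := by exact_mod_cast hlim
      simpa using (this.const_sub (t : ℝ)).mul_const (∫ ω, L 1 ω ∂P)
    exact ge_of_tendsto' hl hbd
  have hnn : 0 ≤ᵐ[P] fun ω => L t ω - Function.leftLim (fun s => L s ω) t := by
    filter_upwards [hmono] with ω h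
    simp only [Pi.zero_apply]
    linarith [(h 0).2]
  have h0 := (integral_eq_zero_iff_of_nonneg_ae hnn ((hi t).sub hint)).1
    (le_antisymm hle (integral_nonneg_of_ae hnn))
  filter_upwards [h0] with ω h
  simp only [Pi.zero_apply] at h
  linarith

end IsSubordinator

/-! ### Moments and paths of two-sided subordinators -/

theorem min_eq_half_sub_abs (x y : ℝ) : min x y = (x + y - |x - y|) / 2 := by
  simp only [abs_eq_max_neg]
  grind

/-- A square integrable process on the line with mean `m t` and with the covariance function of a
two-sided process with stationary independent increments of variance `v` per unit of time. -/
structure HasLinearMoments {Ω : Type*} [MeasurableSpace Ω] (P : Measure Ω) (S : ℝ → Ω → ℝ)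
    (m v : ℝ) : Prop where
  memLp : ∀ t, MemLp (S t) 2 P
  mean : ∀ t, ∫ ω, S t ω ∂P = m * t
  cov : ∀ s t, cov[S s, S t; P] = v * ((|s| + |t| - |s - t|) / 2)

theorem covariance_congr_ae {Ω : Type*} [MeasurableSpace Ω] {P : Measure Ω} {X X' Y Y' : Ω → ℝ}
    (hX : X =ᵐ[P] X') (hY : Y =ᵐ[P] Y') : cov[X, Y; P] = cov[X', Y'; P] := by
  rw [covariance, covariance, integral_congr_ae hX, integral_congr_ae hY]
  refine integral_congr_ae ?_
  filter_upwards [hX, hY] with ω h h'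
  rw [h, h']

section

variable {Ω : Type*} [MeasurableSpace Ω] {P : Measure Ω} [IsProbabilityMeasure P]

omit [IsProbabilityMeasure P] in
theorem HasLinearMoments.congr {S T : ℝ → Ω → ℝ} {m v : ℝ} (h : HasLinearMoments P S m v)
    (hST : ∀ t, S t =ᵐ[P] T t) : HasLinearMoments P T m v where
  memLp t := (memLp_congr_ae (hST t)).1 (h.memLp t)
  mean t := by rw [← h.mean t]; exact (integral_congr_ae (hST t)).symm
  cov s t := by rw [← h.cov s t]; exact (covariance_congr_ae (hST s) (hST t)).symm

theorem IsTwoSidedSubordinator.hasLinearMoments {S : ℝ → Ω → ℝ}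
    (hS : IsTwoSidedSubordinator P S) (hS2 : MemLp (S 1) 2 P) :
    HasLinearMoments P S (∫ ω, S 1 ω ∂P) Var[S 1; P] := by
  obtain ⟨L₁, L₂, h₁, h₂, hind, hid, hpath⟩ := hS.exists_copies
  have hS1 : S 1 =ᵐ[P] L₂ 1 := by
    filter_upwards [hpath] with ω h
    have := h 1
    rw [if_neg (by norm_num)] at this
    simpa using this
  have hid1 : IdentDistrib (L₁ 1) (L₂ 1) P P := hid.comp (measurable_pi_apply 1)
  have m₂ : MemLp (L₂ 1) 2 P := (memLp_congr_ae hS1).1 hS2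
  have m₁ : MemLp (L₁ 1) 2 P := hid1.memLp_iff.2 m₂
  have e₂ : ∫ ω, L₂ 1 ω ∂P = ∫ ω, S 1 ω ∂P := (integral_congr_ae hS1).symm
  have e₁ : ∫ ω, L₁ 1 ω ∂P = ∫ ω, S 1 ω ∂P := hid1.integral_eq.trans e₂
  have v₂ : Var[L₂ 1; P] = Var[S 1; P] := (variance_congr hS1).symm
  have v₁ : Var[L₁ 1; P] = Var[S 1; P] := hid1.variance_eq.trans v₂
  -- At each fixed time the left limit of `L₁` may be replaced by its value, so the moments can be
  -- computed from `L₁` and `L₂` directly.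
  let R : ℝ → Ω → ℝ := fun t ω => if t < 0 then - L₁ (-t).toNNReal ω else L₂ t.toNNReal ω
  have hR : ∀ t, R t =ᵐ[P] S t := by
    intro t
    filter_upwards [hpath, h₁.leftLim_ae_eq m₁ (-t).toNNReal] with ω h hl
    rw [h t, hl]
  have Rneg : ∀ t < 0, R t = - L₁ (-t).toNNReal := by
    intro t ht; ext ω; simp [R, ht]
  have Rpos : ∀ t, 0 ≤ t → R t = L₂ t.toNNReal := by
    intro t ht; ext ω; simp [R, not_lt.2 ht]
  refine HasLinearMoments.congr (S := R) ⟨fun t => ?_, fun t => ?_, ?_⟩ hR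
  · rcases lt_or_ge t 0 with ht | ht
    · rw [Rneg t ht]; exact (h₁.memLp m₁ _).neg
    · rw [Rpos t ht]; exact h₂.memLp m₂ _
  · rcases lt_or_ge t 0 with ht | ht
    · rw [Rneg t ht]
      simp only [Pi.neg_apply, integral_neg]
      rw [h₁.integral_eq m₁, e₁, Real.coe_toNNReal _ (by linarith)]; ring
    · rw [Rpos t ht, h₂.integral_eq m₂, e₂, Real.coe_toNNReal _ ht]; ring
  · have hmixed : ∀ s t, s < 0 → 0 ≤ t →
        cov[R s, R t; P] = Var[S 1; P] * ((|s| + |t| - |s - t|) / 2) := by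
      intro s t hs ht
      have hi : IndepFun (L₁ (-s).toNNReal) (L₂ t.toNNReal) P :=
        hind.comp (measurable_pi_apply _) (measurable_pi_apply _)
      rw [Rneg s hs, Rpos t ht, covariance_neg_left,
        hi.covariance_eq_zero (h₁.memLp m₁ _) (h₂.memLp m₂ _), abs_of_neg hs, abs_of_nonneg ht,
        abs_of_neg (by linarith)]
      ring
    intro s t
    rcases lt_or_ge s 0 with hs | hs <;> rcases lt_or_ge t 0 with ht | ht
    · rw [Rneg s hs, Rneg t ht, covariance_neg_left, covariance_neg_right, neg_neg,
        h₁.covariance_eq m₁, v₁, NNReal.coe_min, Real.coe_toNNReal _ (by linarith),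
        Real.coe_toNNReal _ (by linarith), abs_of_neg hs, abs_of_neg ht, min_eq_half_sub_abs]
      rw [show -s - -t = -(s - t) by ring, abs_neg]
      ring
    · exact hmixed s t hs ht
    · rw [covariance_comm, hmixed t s ht hs, abs_sub_comm]; ring
    · rw [Rpos s hs, Rpos t ht, h₂.covariance_eq m₂, v₂, NNReal.coe_min, Real.coe_toNNReal _ hs,
        Real.coe_toNNReal _ ht, abs_of_nonneg hs, abs_of_nonneg ht, min_eq_half_sub_abs]
      ring

omit [IsProbabilityMeasure P] in
-- On the negative axis, the left limits of a nondecreasing path form a left-continuous function,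
-- which time reversal makes right-continuous. Monotonicity across zero holds because the two
-- branches have opposite signs.
theorem IsTwoSidedSubordinator.ae_path {S : ℝ → Ω → ℝ} (hS : IsTwoSidedSubordinator P S) :
    ∀ᵐ ω ∂P, Monotone (fun t => S t ω) ∧
      ∀ t, ContinuousWithinAt (fun s => S s ω) (Ici t) t := by
  obtain ⟨L₁, L₂, h₁, h₂, -, -, hpath⟩ := hS.exists_copies
  filter_upwards [hpath, h₁.monotone, h₂.monotone, h₁.ae_nonneg, h₂.ae_nonneg, h₂.rightCts]
    with ω h m₁ m₂ n₁ n₂ r₂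
  have hneg : ∀ t < 0, S t ω = - Function.leftLim (fun s => L₁ s ω) (-t).toNNReal := by
    intro t ht; rw [h t, if_pos ht]
  have hpos : ∀ t, 0 ≤ t → S t ω = L₂ t.toNNReal ω := by
    intro t ht; rw [h t, if_neg (not_lt.2 ht)]
  constructor
  · intro s t hst
    simp only
    rcases lt_or_ge s 0 with hs | hs <;> rcases lt_or_ge t 0 with ht | ht
    · rw [hneg s hs, hneg t ht]
      exact neg_le_neg (m₁.leftLim (Real.toNNReal_le_toNNReal (by linarith)))
    · rw [hneg s hs, hpos t ht]
      have h0 : 0 ≤ Function.leftLim (fun s => L₁ s ω) (-s).toNNReal :=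
        (n₁ 0).trans (m₁.le_leftLim (Real.toNNReal_pos.2 (by linarith)))
      linarith [n₂ t.toNNReal]
    · linarith
    · rw [hpos s hs, hpos t ht]
      exact m₂ (Real.toNNReal_le_toNNReal hst)
  · intro t
    rcases lt_or_ge t 0 with ht | ht
    · have hc := continuousWithinAt_leftLim_Iic (f := fun s => L₁ s ω) (a := (-t).toNNReal)
        (m₁.tendsto_leftLim _)
      have hmap : ContinuousWithinAt (fun s : ℝ => (-s).toNNReal) (Ici t) t :=
        (continuous_real_toNNReal.comp continuous_neg).continuousWithinAt
      have := (hc.comp (f := fun s : ℝ => (-s).toNNReal) hmap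
        (fun s hs => Real.toNNReal_le_toNNReal (neg_le_neg hs))).neg
      refine this.congr_of_eventuallyEq ?_ (hneg t ht)
      filter_upwards [mem_nhdsWithin_of_mem_nhds (Iio_mem_nhds ht)] with s hs
      exact hneg s hs
    · have hc := r₂ t.toNNReal
      have hmap : ContinuousWithinAt (fun s : ℝ => s.toNNReal) (Ici t) t :=
        continuous_real_toNNReal.continuousWithinAt
      refine (hc.comp hmap (fun s hs => Real.toNNReal_le_toNNReal hs)).congr (fun s hs => ?_)
        (hpos t ht)
      exact hpos s (ht.trans hs)

/-- Second moments of increments of a process with linear moments. -/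
theorem HasLinearMoments.integral_mul {S : ℝ → Ω → ℝ} {m v : ℝ} (h : HasLinearMoments P S m v)
    {a b a' b' : ℝ} (hab : a ≤ b) (hab' : a' ≤ b') :
    ∫ ω, (S b ω - S a ω) * (S b' ω - S a' ω) ∂P =
      v * (volume (Ioc a b ∩ Ioc a' b')).toReal + m ^ 2 * ((b - a) * (b' - a')) := by
  have hc : cov[S b - S a, S b' - S a'; P] = v * (volume (Ioc a b ∩ Ioc a' b')).toReal := by
    rw [covariance_sub_left (h.memLp b) (h.memLp a) ((h.memLp b').sub (h.memLp a')),
      covariance_sub_right (h.memLp b) (h.memLp b') (h.memLp a'),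
      covariance_sub_right (h.memLp a) (h.memLp b') (h.memLp a'), h.cov, h.cov, h.cov, h.cov,
      Ioc_inter_Ioc, Real.volume_Ioc, ENNReal.toReal_ofReal']
    -- The length of the overlap, written in the absolute values that survive when the four
    -- covariances are combined.
    have : max (min b b' - max a a') 0 =
        (|b - a'| + |a - b'| - |b - b'| - |a - a'|) / 2 := by
      simp only [abs_eq_max_neg]
      grind
    simp only [this]
    ring
  have hi : ∀ t, Integrable (S t) P := fun t => (h.memLp t).integrable (by norm_num)
  rw [covariance_eq_sub ((h.memLp b).sub (h.memLp a)) ((h.memLp b').sub (h.memLp a'))] at hc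
  simp only [Pi.mul_apply, Pi.sub_apply] at hc
  rw [integral_sub (hi _) (hi _), integral_sub (hi _) (hi _), h.mean, h.mean, h.mean, h.mean] at hc
  linear_combination hc

end

/-! ### Joint measurability and second moments of mixtures of increments -/

theorem measurable_uncurry_of_rightContinuous {Ω : Type*} {mΩ : MeasurableSpace Ω}
    {Z : ℝ → Ω → ℝ} (hZ : ∀ t, Measurable (Z t))
    (hc : ∀ ω t, ContinuousWithinAt (fun s => Z s ω) (Ici t) t) :
    Measurable fun p : ℝ × Ω => Z p.1 p.2 := by
  -- The `+ 1` keeps the grid points to the right of `t`, so right-continuity suffices; each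
  -- approximation depends on `t` through an integer only.
  let grid : ℕ → ℝ → ℝ := fun n t => (⌊(n + 1) * t⌋ + 1) / (n + 1)
  have hgrid : ∀ t, Tendsto (fun n => grid n t) atTop (𝓝[≥] t) := by
    intro t
    refine tendsto_nhdsWithin_iff.2 ⟨?_, Eventually.of_forall fun n => ?_⟩
    · have hub : Tendsto (fun n : ℕ => t + 1 / ((n : ℝ) + 1)) atTop (𝓝 t) := by
        simpa using tendsto_one_div_add_atTop_nhds_zero_nat.const_add t
      refine tendsto_of_tendsto_of_tendsto_of_le_of_le tendsto_const_nhds hub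
        (fun n => ?_) (fun n => ?_)
      · have hn : (0 : ℝ) < n + 1 := by positivity
        simp only [grid]
        rw [le_div_iff₀ hn]
        nlinarith [Int.lt_floor_add_one (((n : ℝ) + 1) * t)]
      · have hn : (0 : ℝ) < n + 1 := by positivity
        simp only [grid]
        rw [div_le_iff₀ hn, add_mul t, one_div, inv_mul_cancel₀ hn.ne']
        nlinarith [Int.floor_le (((n : ℝ) + 1) * t)]
    · have hn : (0 : ℝ) < n + 1 := by positivity
      simp only [grid, mem_Ici]
      rw [le_div_iff₀ hn]
      nlinarith [Int.lt_floor_add_one (((n : ℝ) + 1) * t)]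
  refine measurable_of_tendsto_metrizable (f := fun n (p : ℝ × Ω) => Z (grid n p.1) p.2)
    (fun n => ?_) (tendsto_pi_nhds.2 fun p => (hc p.2 p.1).tendsto.comp (hgrid p.1))
  have h1 : Measurable fun q : ℤ × Ω => Z ((q.1 + 1) / (n + 1)) q.2 :=
    measurable_from_prod_countable_right fun k => hZ (((k : ℝ) + 1) / (n + 1))
  have h2 : Measurable fun p : ℝ × Ω => (⌊((n : ℝ) + 1) * p.1⌋, p.2) :=
    (Int.measurable_floor.comp (measurable_fst.const_mul _)).prodMk measurable_snd
  exact h1.comp h2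

theorem lintegral_mul_lintegral {X A B : Type*} [MeasurableSpace X] [MeasurableSpace A]
    [MeasurableSpace B] {μ : Measure X} [SFinite μ] {α : Measure A} [SFinite α] {β : Measure B}
    [SFinite β] {f : X → A → ℝ≥0∞} {g : X → B → ℝ≥0∞}
    (hf : Measurable (Function.uncurry f)) (hg : Measurable (Function.uncurry g)) :
    ∫⁻ x, (∫⁻ a, f x a ∂α) * (∫⁻ b, g x b ∂β) ∂μ = ∫⁻ a, ∫⁻ b, ∫⁻ x, f x a * g x b ∂μ ∂β ∂α := by
  have hfx : ∀ x, Measurable (f x) := fun x => hf.comp measurable_prodMk_left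
  have hgx : ∀ x, Measurable (g x) := fun x => hg.comp measurable_prodMk_left
  have h1 : ∀ x, (∫⁻ a, f x a ∂α) * (∫⁻ b, g x b ∂β) = ∫⁻ a, ∫⁻ b, f x a * g x b ∂β ∂α := by
    intro x
    simp_rw [lintegral_const_mul _ (hgx x)]
    rw [lintegral_mul_const _ (hfx x)]
  simp_rw [h1]
  rw [lintegral_lintegral_swap]
  · refine lintegral_congr fun a => ?_
    rw [lintegral_lintegral_swap]
    exact ((hf.comp (measurable_fst.prodMk measurable_const)).mul hg).aemeasurable
  · refine Measurable.aemeasurable ?_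
    refine Measurable.lintegral_prod_right'
      (f := fun q : (X × A) × B => f q.1.1 q.1.2 * g q.1.1 q.2) ?_
    exact (hf.comp measurable_fst).mul
      (hg.comp ((measurable_fst.comp measurable_fst).prodMk measurable_snd))

/-- The integral over intervals `(z.1, z.2]`, weighted by `ρ`, of the increments of `T`. -/
def incrementIntegral {Ω : Type*} (T : ℝ → Ω → ℝ) (ρ : Measure (ℝ × ℝ)) (ω : Ω) : ℝ≥0∞ :=
  ∫⁻ z, ENNReal.ofReal (T z.2 ω - T z.1 ω) ∂ρ

/-- The total weight of the intervals `(z.1, z.2]` that contain `x`. -/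
def overlap (ρ : Measure (ℝ × ℝ)) (x : ℝ) : ℝ≥0∞ :=
  ∫⁻ z, (Ioc z.1 z.2).indicator 1 x ∂ρ

theorem measurable_indicator_Ioc :
    Measurable fun p : ℝ × (ℝ × ℝ) => (Ioc p.2.1 p.2.2).indicator (1 : ℝ → ℝ≥0∞) p.1 := by
  have hs : MeasurableSet ({p : ℝ × (ℝ × ℝ) | p.2.1 < p.1} ∩ {p | p.1 ≤ p.2.2}) :=
    (measurableSet_lt (by fun_prop) (by fun_prop)).inter
      (measurableSet_le (by fun_prop) (by fun_prop))
  exact (measurable_one.indicator hs)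

theorem lintegral_overlap (ρ : Measure (ℝ × ℝ)) [SFinite ρ] :
    ∫⁻ x, overlap ρ x = ∫⁻ z, volume (Ioc z.1 z.2) ∂ρ := by
  simp_rw [overlap]
  rw [lintegral_lintegral_swap measurable_indicator_Ioc.aemeasurable]
  simp_rw [lintegral_indicator_one measurableSet_Ioc]

section

variable {Ω : Type*} [MeasurableSpace Ω]

theorem measurable_incrementIntegral {T : ℝ → Ω → ℝ}
    (hT : Measurable fun p : ℝ × Ω => T p.1 p.2) (ρ : Measure (ℝ × ℝ)) [SFinite ρ] :
    Measurable (incrementIntegral T ρ) := by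
  refine Measurable.lintegral_prod_right'
    (f := fun q : Ω × (ℝ × ℝ) => ENNReal.ofReal (T q.2.2 q.1 - T q.2.1 q.1)) ?_
  exact ENNReal.measurable_ofReal.comp
    ((hT.comp (f := fun q : Ω × (ℝ × ℝ) => (q.2.2, q.1)) (by fun_prop)).sub
      (hT.comp (f := fun q : Ω × (ℝ × ℝ) => (q.2.1, q.1)) (by fun_prop)))

variable {P : Measure Ω} [IsProbabilityMeasure P] {T : ℝ → Ω → ℝ} {m v : ℝ}

/-- The endpoints need not be ordered: for a reversed pair `ENNReal.ofReal` kills the increment and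
`Ioc` is empty, so both sides vanish. Measures on pairs thus need no support condition. -/
theorem HasLinearMoments.lintegral_mul (h : HasLinearMoments P T m v) (hv : 0 ≤ v)
    (hmono : ∀ ω, Monotone fun t => T t ω) (z z' : ℝ × ℝ) :
    ∫⁻ ω, ENNReal.ofReal (T z.2 ω - T z.1 ω) * ENNReal.ofReal (T z'.2 ω - T z'.1 ω) ∂P =
      ENNReal.ofReal v *
        (∫⁻ x, (Ioc z.1 z.2).indicator 1 x * (Ioc z'.1 z'.2).indicator 1 x) +
      ENNReal.ofReal (m ^ 2) * (volume (Ioc z.1 z.2) * volume (Ioc z'.1 z'.2)) := by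
  rcases lt_or_ge z.2 z.1 with hz | hz
  · have : ∀ ω, ENNReal.ofReal (T z.2 ω - T z.1 ω) = 0 := fun ω =>
      ENNReal.ofReal_of_nonpos (sub_nonpos.2 (hmono ω hz.le))
    simp [this, Ioc_eq_empty_of_le hz.le]
  rcases lt_or_ge z'.2 z'.1 with hz' | hz'
  · have : ∀ ω, ENNReal.ofReal (T z'.2 ω - T z'.1 ω) = 0 := fun ω =>
      ENNReal.ofReal_of_nonpos (sub_nonpos.2 (hmono ω hz'.le))
    simp [this, Ioc_eq_empty_of_le hz'.le]
  have h0 : ∀ ω, 0 ≤ T z.2 ω - T z.1 ω := fun ω => sub_nonneg.2 (hmono ω hz)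
  have h0' : ∀ ω, 0 ≤ T z'.2 ω - T z'.1 ω := fun ω => sub_nonneg.2 (hmono ω hz')
  have hint : Integrable (fun ω => (T z.2 ω - T z.1 ω) * (T z'.2 ω - T z'.1 ω)) P :=
    ((h.memLp _).sub (h.memLp _)).integrable_mul ((h.memLp _).sub (h.memLp _))
  have e1 := ofReal_integral_eq_lintegral_ofReal hint
    (ae_of_all _ fun ω => mul_nonneg (h0 ω) (h0' ω))
  simp_rw [← ENNReal.ofReal_mul (h0 _)]
  rw [← e1, h.integral_mul hz hz']
  have e2 : ∀ x : ℝ, (Ioc z.1 z.2).indicator (1 : ℝ → ℝ≥0∞) x * (Ioc z'.1 z'.2).indicator 1 x =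
      (Ioc z.1 z.2 ∩ Ioc z'.1 z'.2).indicator 1 x := fun x => by
    rw [inter_indicator_one]; rfl
  simp_rw [e2]
  rw [lintegral_indicator_one (measurableSet_Ioc.inter measurableSet_Ioc),
    ENNReal.ofReal_add (by positivity) (mul_nonneg (sq_nonneg m)
      (mul_nonneg (sub_nonneg.2 hz) (sub_nonneg.2 hz'))), ENNReal.ofReal_mul hv,
      ENNReal.ofReal_toReal, ENNReal.ofReal_mul (sq_nonneg m),
      ENNReal.ofReal_mul (sub_nonneg.2 hz), Real.volume_Ioc, Real.volume_Ioc]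
  exact ((measure_mono inter_subset_left).trans_lt measure_Ioc_lt_top).ne

/-- The formula for two intervals is integrated against both weights. In `ℝ≥0∞` Tonelli requires no
integrability, so finiteness of the pathwise integrals is a consequence of the formula and not an
assumption. -/
theorem HasLinearMoments.lintegral_incrementIntegral_mul (h : HasLinearMoments P T m v)
    (hv : 0 ≤ v) (hmono : ∀ ω, Monotone fun t => T t ω)
    (hT : Measurable fun p : ℝ × Ω => T p.1 p.2)
    (ρ ρ' : Measure (ℝ × ℝ)) [SFinite ρ] [SFinite ρ'] :
    ∫⁻ ω, incrementIntegral T ρ ω * incrementIntegral T ρ' ω ∂P =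
      ENNReal.ofReal v * (∫⁻ x, overlap ρ x * overlap ρ' x) +
      ENNReal.ofReal (m ^ 2) * ((∫⁻ x, overlap ρ x) * ∫⁻ x, overlap ρ' x) := by
  have hm : Measurable (Function.uncurry fun (ω : Ω) (z : ℝ × ℝ) =>
      ENNReal.ofReal (T z.2 ω - T z.1 ω)) :=
    ENNReal.measurable_ofReal.comp
      ((hT.comp (f := fun q : Ω × (ℝ × ℝ) => (q.2.2, q.1)) (by fun_prop)).sub
        (hT.comp (f := fun q : Ω × (ℝ × ℝ) => (q.2.1, q.1)) (by fun_prop)))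
  have hvol : Measurable fun z : ℝ × ℝ => volume (Ioc z.1 z.2) := by
    simp_rw [Real.volume_Ioc]; fun_prop
  have hI : Measurable fun q : (ℝ × ℝ) × (ℝ × ℝ) => ∫⁻ x,
      (Ioc q.1.1 q.1.2).indicator (1 : ℝ → ℝ≥0∞) x * (Ioc q.2.1 q.2.2).indicator 1 x := by
    refine Measurable.lintegral_prod_right' (f := fun p : ((ℝ × ℝ) × (ℝ × ℝ)) × ℝ =>
      (Ioc p.1.1.1 p.1.1.2).indicator (1 : ℝ → ℝ≥0∞) p.2 *
        (Ioc p.1.2.1 p.1.2.2).indicator 1 p.2) ?_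
    exact (measurable_indicator_Ioc.comp (f := fun p : ((ℝ × ℝ) × (ℝ × ℝ)) × ℝ =>
        (p.2, p.1.1)) (by fun_prop)).mul
      (measurable_indicator_Ioc.comp (f := fun p : ((ℝ × ℝ) × (ℝ × ℝ)) × ℝ =>
        (p.2, p.1.2)) (by fun_prop))
  simp_rw [incrementIntegral]
  rw [lintegral_mul_lintegral hm hm]
  simp_rw [h.lintegral_mul hv hmono]
  rw [lintegral_overlap, lintegral_overlap]
  simp_rw [overlap]
  rw [lintegral_mul_lintegral (f := fun (x : ℝ) (z : ℝ × ℝ) => (Ioc z.1 z.2).indicator 1 x)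
    (g := fun (x : ℝ) (z : ℝ × ℝ) => (Ioc z.1 z.2).indicator 1 x)
    measurable_indicator_Ioc measurable_indicator_Ioc]
  have e : ∀ z : ℝ × ℝ, ∫⁻ z' : ℝ × ℝ, (ENNReal.ofReal v *
        (∫⁻ x, (Ioc z.1 z.2).indicator 1 x * (Ioc z'.1 z'.2).indicator 1 x) +
      ENNReal.ofReal (m ^ 2) * (volume (Ioc z.1 z.2) * volume (Ioc z'.1 z'.2))) ∂ρ' =
      ENNReal.ofReal v *
        (∫⁻ z' : ℝ × ℝ, ∫⁻ x, (Ioc z.1 z.2).indicator 1 x *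
          (Ioc z'.1 z'.2).indicator 1 x ∂volume ∂ρ') +
      ENNReal.ofReal (m ^ 2) * (volume (Ioc z.1 z.2) *
        ∫⁻ z' : ℝ × ℝ, volume (Ioc z'.1 z'.2) ∂ρ') := by
    intro z
    have hIz : Measurable fun z' : ℝ × ℝ => ∫⁻ x,
        (Ioc z.1 z.2).indicator (1 : ℝ → ℝ≥0∞) x * (Ioc z'.1 z'.2).indicator 1 x :=
      hI.comp measurable_prodMk_left
    rw [lintegral_add_right _ ((hvol.const_mul _).const_mul _),
      lintegral_const_mul _ hIz,
      lintegral_const_mul _ (hvol.const_mul _), lintegral_const_mul _ hvol]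
  simp_rw [e]
  rw [lintegral_add_right _ ((hvol.mul_const _).const_mul _),
    lintegral_const_mul _ hI.lintegral_prod_right',
    lintegral_const_mul _ (hvol.mul_const _), lintegral_mul_const _ hvol]

/-- The isometry between the square integrable functionals `incrementIntegral T ρ` and the
deterministic functions `overlap ρ`, in terms of real integrals. -/
theorem HasLinearMoments.integral_incrementIntegral_mul (h : HasLinearMoments P T m v)
    (hv : 0 ≤ v) (hmono : ∀ ω, Monotone fun t => T t ω)
    (hT : Measurable fun p : ℝ × Ω => T p.1 p.2)
    {ρ ρ' : Measure (ℝ × ℝ)} [SFinite ρ] [SFinite ρ'] {F F' : ℝ → ℝ}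
    (hF : ∀ x, overlap ρ x = ENNReal.ofReal (F x)) (hF' : ∀ x, overlap ρ' x = ENNReal.ofReal (F' x))
    (F0 : ∀ x, 0 ≤ F x) (F0' : ∀ x, 0 ≤ F' x)
    (F1 : Integrable F) (F1' : Integrable F') (F2 : MemLp F 2) (F2' : MemLp F' 2) :
    ∫ ω, (incrementIntegral T ρ ω).toReal * (incrementIntegral T ρ' ω).toReal ∂P =
      v * (∫ x, F x * F' x) + m ^ 2 * ((∫ x, F x) * ∫ x, F' x) := by
  have key := h.lintegral_incrementIntegral_mul hv hmono hT ρ ρ'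
  have hFF : Integrable (fun x => F x * F' x) := F2.integrable_mul F2'
  simp_rw [hF, hF', ← ENNReal.ofReal_mul (F0 _)] at key
  rw [← ofReal_integral_eq_lintegral_ofReal F1 (ae_of_all _ F0),
    ← ofReal_integral_eq_lintegral_ofReal F1' (ae_of_all _ F0'),
    ← ofReal_integral_eq_lintegral_ofReal hFF (ae_of_all _ fun x => mul_nonneg (F0 x) (F0' x)),
    ← ENNReal.ofReal_mul (integral_nonneg F0), ← ENNReal.ofReal_mul hv,
    ← ENNReal.ofReal_mul (sq_nonneg m), ← ENNReal.ofReal_add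
      (mul_nonneg hv (integral_nonneg fun x => mul_nonneg (F0 x) (F0' x)))
      (mul_nonneg (sq_nonneg m) (mul_nonneg (integral_nonneg F0) (integral_nonneg F0')))] at key
  simp_rw [← ENNReal.toReal_mul]
  have hm : Measurable fun ω => incrementIntegral T ρ ω * incrementIntegral T ρ' ω :=
    (measurable_incrementIntegral hT ρ).mul (measurable_incrementIntegral hT ρ')
  rw [integral_toReal hm.aemeasurable 
    (ae_lt_top hm (key.trans_ne ENNReal.ofReal_ne_top)), key,
    ENNReal.toReal_ofReal (add_nonneg
      (mul_nonneg hv (integral_nonneg fun x => mul_nonneg (F0 x) (F0' x)))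
      (mul_nonneg (sq_nonneg m) (mul_nonneg (integral_nonneg F0) (integral_nonneg F0'))))]

theorem HasLinearMoments.lintegral_incrementIntegral_sq_lt_top (h : HasLinearMoments P T m v)
    (hv : 0 ≤ v) (hmono : ∀ ω, Monotone fun t => T t ω)
    (hT : Measurable fun p : ℝ × Ω => T p.1 p.2)
    {ρ : Measure (ℝ × ℝ)} [SFinite ρ] {F : ℝ → ℝ}
    (hF : ∀ x, overlap ρ x = ENNReal.ofReal (F x)) (F0 : ∀ x, 0 ≤ F x)
    (F1 : Integrable F) (F2 : MemLp F 2) :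
    ∫⁻ ω, incrementIntegral T ρ ω ^ 2 ∂P < ∞ := by
  have hFF : Integrable (fun x => F x * F x) := F2.integrable_mul F2
  simp_rw [sq]
  rw [h.lintegral_incrementIntegral_mul hv hmono hT ρ ρ]
  simp_rw [hF, ← ENNReal.ofReal_mul (F0 _)]
  rw [← ofReal_integral_eq_lintegral_ofReal F1 (ae_of_all _ F0),
    ← ofReal_integral_eq_lintegral_ofReal hFF (ae_of_all _ fun x => mul_nonneg (F0 x) (F0 x)),
    ← ENNReal.ofReal_mul (integral_nonneg F0), ← ENNReal.ofReal_mul hv,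
    ← ENNReal.ofReal_mul (sq_nonneg m)]
  exact ENNReal.add_lt_top.2 ⟨ENNReal.ofReal_lt_top, ENNReal.ofReal_lt_top⟩

theorem HasLinearMoments.ae_incrementIntegral_lt_top (h : HasLinearMoments P T m v)
    (hv : 0 ≤ v) (hmono : ∀ ω, Monotone fun t => T t ω)
    (hT : Measurable fun p : ℝ × Ω => T p.1 p.2)
    {ρ : Measure (ℝ × ℝ)} [SFinite ρ] {F : ℝ → ℝ}
    (hF : ∀ x, overlap ρ x = ENNReal.ofReal (F x)) (F0 : ∀ x, 0 ≤ F x)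
    (F1 : Integrable F) (F2 : MemLp F 2) :
    ∀ᵐ ω ∂P, incrementIntegral T ρ ω < ∞ := by
  filter_upwards [ae_lt_top ((measurable_incrementIntegral hT ρ).pow_const 2)
    (h.lintegral_incrementIntegral_sq_lt_top hv hmono hT hF F0 F1 F2).ne] with ω hω
  by_contra hn
  rw [not_lt_top_iff] at hn
  simp [hn] at hω

theorem HasLinearMoments.memLp_incrementIntegral (h : HasLinearMoments P T m v)
    (hv : 0 ≤ v) (hmono : ∀ ω, Monotone fun t => T t ω)
    (hT : Measurable fun p : ℝ × Ω => T p.1 p.2)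
    {ρ : Measure (ℝ × ℝ)} [SFinite ρ] {F : ℝ → ℝ}
    (hF : ∀ x, overlap ρ x = ENNReal.ofReal (F x)) (F0 : ∀ x, 0 ≤ F x)
    (F1 : Integrable F) (F2 : MemLp F 2) :
    MemLp (fun ω => (incrementIntegral T ρ ω).toReal) 2 P := by
  have hm := measurable_incrementIntegral hT ρ
  rw [memLp_two_iff_integrable_sq hm.ennreal_toReal.aestronglyMeasurable]
  simp_rw [← ENNReal.toReal_pow]
  exact integrable_toReal_of_lintegral_ne_top (hm.pow_const 2).aemeasurable
    (h.lintegral_incrementIntegral_sq_lt_top hv hmono hT hF F0 F1 F2).ne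

end

/-! ### The isometry for elementary integrals -/

theorem eLpNorm_two_sq {X : Type*} [MeasurableSpace X] {μ : Measure X} {f : X → ℝ}
    (hf : MemLp f 2 μ) : eLpNorm f 2 μ ^ 2 = ENNReal.ofReal (∫ x, f x ^ 2 ∂μ) := by
  have h := eLpNorm_nnreal_pow_eq_lintegral (f := f) (μ := μ) (p := 2) (by norm_num)
  have h' : eLpNorm f 2 μ ^ 2 = ∫⁻ x, ‖f x‖ₑ ^ 2 ∂μ := by
    have e : ((2 : ℝ≥0) : ℝ) = ((2 : ℕ) : ℝ) := by norm_num
    simp only [e, ENNReal.rpow_natCast] at h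
    exact_mod_cast h
  rw [h', ofReal_integral_eq_lintegral_ofReal hf.integrable_sq (ae_of_all _ fun x => sq_nonneg _)]
  refine lintegral_congr fun x => ?_
  rw [Real.enorm_eq_ofReal_abs, ← ENNReal.ofReal_pow (abs_nonneg _), sq_abs]

section

variable {Ω : Type*} [MeasurableSpace Ω] {P : Measure Ω} [IsProbabilityMeasure P]

omit [IsProbabilityMeasure P] in
theorem integral_sum_sq_of_bilinear {ι : Type*} [Fintype ι] {Y : ι → Ω → ℝ} {F : ι → ℝ → ℝ}
    {m v : ℝ} (hY : ∀ i, MemLp (Y i) 2 P) (hF1 : ∀ i, Integrable (F i))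
    (hF2 : ∀ i, MemLp (F i) 2)
    (h : ∀ i j, ∫ ω, Y i ω * Y j ω ∂P =
      v * (∫ x, F i x * F j x) + m ^ 2 * ((∫ x, F i x) * ∫ x, F j x)) (c : ι → ℝ) :
    ∫ ω, (∑ i, c i * Y i ω) ^ 2 ∂P =
      v * (∫ x, (∑ i, c i * F i x) ^ 2) + m ^ 2 * (∫ x, ∑ i, c i * F i x) ^ 2 := by
  have hYY : ∀ i j, Integrable (fun ω => c i * Y i ω * (c j * Y j ω)) P := fun i j =>
    ((hY i).const_mul (c i)).integrable_mul ((hY j).const_mul (c j))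
  have hFF : ∀ i j, Integrable (fun x => c i * F i x * (c j * F j x)) := fun i j =>
    ((hF2 i).const_mul (c i)).integrable_mul ((hF2 j).const_mul (c j))
  simp_rw [sq, Finset.sum_mul_sum]
  rw [integral_finsetSum _ (fun i _ => integrable_finsetSum _ fun j _ => hYY i j),
    integral_finsetSum _ (fun i _ => integrable_finsetSum _ fun j _ => hFF i j),
    integral_finsetSum _ (fun i _ => (hF1 i).const_mul (c i)), Finset.sum_mul_sum,
    Finset.mul_sum, Finset.mul_sum, ← Finset.sum_add_distrib]
  refine Finset.sum_congr rfl fun i _ => ?_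
  rw [integral_finsetSum _ (fun j _ => hYY i j), integral_finsetSum _ (fun j _ => hFF i j),
    Finset.mul_sum, Finset.mul_sum, ← Finset.sum_add_distrib]
  refine Finset.sum_congr rfl fun j _ => ?_
  have e1 : ∀ ω, c i * Y i ω * (c j * Y j ω) = c i * c j * (Y i ω * Y j ω) := fun ω => by ring
  have e2 : ∀ x, c i * F i x * (c j * F j x) = c i * c j * (F i x * F j x) := fun x => by ring
  simp_rw [e1, e2, integral_const_mul]
  rw [h i j]
  ring

omit [MeasurableSpace Ω] in
-- A single increment is the mixture with Dirac weight, so elementary integrals and pathwise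
-- integrals fall under one second moment formula.
theorem incrementIntegral_dirac (T : ℝ → Ω → ℝ) (hmono : ∀ ω, Monotone fun t => T t ω) {a b : ℝ}
    (hab : a ≤ b) (ω : Ω) :
    (incrementIntegral T (Measure.dirac (a, b)) ω).toReal = T b ω - T a ω := by
  rw [incrementIntegral, lintegral_dirac, ENNReal.toReal_ofReal (sub_nonneg.2 (hmono ω hab))]

theorem overlap_dirac (a b x : ℝ) : overlap (Measure.dirac (a, b)) x =
    ENNReal.ofReal ((Ioc a b).indicator (fun _ => 1) x) := by
  rw [overlap, lintegral_dirac]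
  by_cases hx : x ∈ Ioc a b <;> simp [hx]

theorem integrable_indicator_Ioc_one (a b : ℝ) :
    Integrable ((Ioc a b).indicator fun _ => (1 : ℝ)) :=
  (integrable_indicator_iff measurableSet_Ioc).2 (integrableOn_const (by simp))

theorem memLp_indicator_Ioc_one (a b : ℝ) : MemLp ((Ioc a b).indicator fun _ => (1 : ℝ)) 2 :=
  memLp_indicator_const 2 measurableSet_Ioc 1 (Or.inr (by simp))

variable {T : ℝ → Ω → ℝ} {m v : ℝ}

omit [IsProbabilityMeasure P] in
theorem HasLinearMoments.memLp_integral (h : HasLinearMoments P T m v) (φ : StepFunction) :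
    MemLp (φ.integral T) 2 P :=
  memLp_finsetSum _ fun _ _ => ((h.memLp _).sub (h.memLp _)).const_mul _

theorem StepFunction.toFun_eq (φ : StepFunction) (x : ℝ) : φ.toFun x =
    ∑ i, φ.coeff i * (Ioc (φ.left i) (φ.right i)).indicator (fun _ => 1) x := by
  refine Finset.sum_congr rfl fun i _ => ?_
  by_cases hx : x ∈ Ioc (φ.left i) (φ.right i) <;> simp [hx]

theorem StepFunction.memLp_toFun (φ : StepFunction) : MemLp φ.toFun 2 := by
  rw [funext φ.toFun_eq]
  exact memLp_finsetSum _ fun i _ => (memLp_indicator_Ioc_one _ _).const_mul _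

/-- The difference is a finite linear combination of mixtures, so bilinearity applies. The factor
`c` admits negative kernels, which occur for negative times. -/
theorem HasLinearMoments.integral_step_sub_sq (h : HasLinearMoments P T m v)
    (hv : 0 ≤ v) (hmono : ∀ ω, Monotone fun t => T t ω)
    (hT : Measurable fun p : ℝ × Ω => T p.1 p.2)
    {ρ : Measure (ℝ × ℝ)} [SFinite ρ] {F : ℝ → ℝ}
    (hF : ∀ x, overlap ρ x = ENNReal.ofReal (F x)) (F0 : ∀ x, 0 ≤ F x)
    (F1 : Integrable F) (F2 : MemLp F 2) (φ : StepFunction) (c : ℝ) :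
    ∫ ω, (φ.integral T ω - c * (incrementIntegral T ρ ω).toReal) ^ 2 ∂P =
      v * (∫ x, (φ.toFun x - c * F x) ^ 2) + m ^ 2 * (∫ x, (φ.toFun x - c * F x)) ^ 2 := by
  -- `none` carries the mixture `ρ` with coefficient `-c`; `some k` carries the `k`-th step.
  let R : Option (Fin φ.n) → Measure (ℝ × ℝ) := fun i =>
    i.elim ρ fun k => Measure.dirac (φ.left k, φ.right k)
  let G : Option (Fin φ.n) → ℝ → ℝ := fun i =>
    i.elim F fun k => (Ioc (φ.left k) (φ.right k)).indicator fun _ => 1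
  have hR : ∀ i, SFinite (R i) := by
    rintro (_ | k)
    · exact inferInstanceAs (SFinite ρ)
    · exact inferInstanceAs (SFinite (Measure.dirac (φ.left k, φ.right k)))
  have hRG : ∀ i x, overlap (R i) x = ENNReal.ofReal (G i x) := by
    rintro (_ | k) x
    · exact hF x
    · exact overlap_dirac _ _ x
  have G0 : ∀ i x, 0 ≤ G i x := by
    rintro (_ | k) x
    · exact F0 x
    · exact indicator_nonneg (fun _ _ => zero_le_one) x
  have G1 : ∀ i, Integrable (G i) := by
    rintro (_ | k)
    · exact F1
    · exact integrable_indicator_Ioc_one _ _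
  have G2 : ∀ i, MemLp (G i) 2 := by
    rintro (_ | k)
    · exact F2
    · exact memLp_indicator_Ioc_one _ _
  have key := integral_sum_sq_of_bilinear (P := P)
    (Y := fun i ω => (incrementIntegral T (R i) ω).toReal) (F := G) (m := m) (v := v)
    (fun i => h.memLp_incrementIntegral hv hmono hT (hRG i) (G0 i) (G1 i) (G2 i)) G1 G2
    (fun i j => h.integral_incrementIntegral_mul hv hmono hT (hRG i) (hRG j) (G0 i) (G0 j)
      (G1 i) (G1 j) (G2 i) (G2 j)) (fun i => i.elim (-c) φ.coeff)
  have e1 : ∀ ω, ∑ i : Option (Fin φ.n), i.elim (-c) φ.coeff *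
      (incrementIntegral T (R i) ω).toReal =
      φ.integral T ω - c * (incrementIntegral T ρ ω).toReal := by
    intro ω
    rw [Fintype.sum_option, StepFunction.integral]
    simp only [R, Option.elim]
    simp_rw [incrementIntegral_dirac T hmono (φ.left_le_right _)]
    ring
  have e2 : ∀ x, ∑ i : Option (Fin φ.n), i.elim (-c) φ.coeff * G i x =
      φ.toFun x - c * F x := by
    intro x
    rw [Fintype.sum_option, φ.toFun_eq]
    simp only [G, Option.elim]
    ring
  simp_rw [e1, e2] at key
  exact key

/-- In the isometry the variance term is controlled by the `L²` distance and the mean term by the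
`L¹` distance, which is why both convergences are required. -/
theorem HasLinearMoments.tendsto_integral_step (h : HasLinearMoments P T m v)
    (hv : 0 ≤ v) (hmono : ∀ ω, Monotone fun t => T t ω)
    (hT : Measurable fun p : ℝ × Ω => T p.1 p.2)
    {ρ : Measure (ℝ × ℝ)} [SFinite ρ] {F : ℝ → ℝ}
    (hF : ∀ x, overlap ρ x = ENNReal.ofReal (F x)) (F0 : ∀ x, 0 ≤ F x)
    (F1 : Integrable F) (F2 : MemLp F 2) (φ : ℕ → StepFunction) (c : ℝ)
    (h1 : Tendsto (fun n => eLpNorm (fun x => (φ n).toFun x - c * F x) 1) atTop (𝓝 0))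
    (h2 : Tendsto (fun n => eLpNorm (fun x => (φ n).toFun x - c * F x) 2) atTop (𝓝 0)) :
    Tendsto (fun n => eLpNorm
      (fun ω => (φ n).integral T ω - c * (incrementIntegral T ρ ω).toReal) 2 P) atTop (𝓝 0) := by
  have hY := h.memLp_incrementIntegral hv hmono hT hF F0 F1 F2
  have hbound : ∀ n, eLpNorm
      (fun ω => (φ n).integral T ω - c * (incrementIntegral T ρ ω).toReal) 2 P ^ 2 ≤
      ENNReal.ofReal v * eLpNorm (fun x => (φ n).toFun x - c * F x) 2 ^ 2 +
      ENNReal.ofReal (m ^ 2) * eLpNorm (fun x => (φ n).toFun x - c * F x) 1 ^ 2 := by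
    intro n
    have g2 : MemLp (fun x => (φ n).toFun x - c * F x) 2 :=
      (φ n).memLp_toFun.sub (F2.const_mul c)
    have g3 : MemLp (fun ω => (φ n).integral T ω - c * (incrementIntegral T ρ ω).toReal) 2 P :=
      (h.memLp_integral (φ n)).sub (hY.const_mul c)
    rw [eLpNorm_two_sq g3, eLpNorm_two_sq g2,
      h.integral_step_sub_sq hv hmono hT hF F0 F1 F2,
      ENNReal.ofReal_add (mul_nonneg hv (integral_nonneg fun x => sq_nonneg _)) (by positivity),
      ENNReal.ofReal_mul hv, ENNReal.ofReal_mul (sq_nonneg m)]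
    gcongr
    rw [← sq_abs, ENNReal.ofReal_pow (abs_nonneg _), ← Real.enorm_eq_ofReal_abs,
      eLpNorm_one_eq_lintegral_enorm]
    gcongr
    exact enorm_integral_le_lintegral_enorm _
  have hlim : Tendsto (fun n =>
      ENNReal.ofReal v * eLpNorm (fun x => (φ n).toFun x - c * F x) 2 ^ 2 +
      ENNReal.ofReal (m ^ 2) * eLpNorm (fun x => (φ n).toFun x - c * F x) 1 ^ 2) atTop (𝓝 0) := by
    have a1 := ENNReal.Tendsto.const_mul (a := ENNReal.ofReal v) (ENNReal.Tendsto.pow (n := 2) h2)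
      (Or.inr ENNReal.ofReal_ne_top)
    have a2 := ENNReal.Tendsto.const_mul (a := ENNReal.ofReal (m ^ 2))
      (ENNReal.Tendsto.pow (n := 2) h1)
      (Or.inr ENNReal.ofReal_ne_top)
    simpa using a1.add a2
  have hsq := tendsto_of_tendsto_of_tendsto_of_le_of_le tendsto_const_nhds hlim
    (fun n => zero_le) hbound
  have := (ENNReal.continuous_rpow_const (y := ((2 : ℕ) : ℝ)⁻¹)).tendsto 0 |>.comp hsq
  rw [ENNReal.zero_rpow_of_pos (by norm_num)] at this
  exact (tendsto_congr fun n => ENNReal.pow_rpow_inv_natCast two_ne_zero _).1 this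

end

/-! ### Approximation by step functions -/

theorem sum_indicator_Ioc {u : ℕ → ℝ} (hu : Monotone u) (n : ℕ) (x : ℝ) :
    ∑ k ∈ Finset.range n, (Ioc (u k) (u (k + 1))).indicator (fun _ => (1 : ℝ)) x =
      (Ioc (u 0) (u n)).indicator (fun _ => 1) x := by
  have h : ∀ a b : ℝ, a ≤ b → (Ioc a b).indicator (fun _ => (1 : ℝ)) x =
      (Iic b).indicator (fun _ => 1) x - (Iic a).indicator (fun _ => 1) x := by
    intro a b hab
    simp only [indicator_apply, mem_Ioc, mem_Iic]
    grind
  rw [h _ _ (hu (zero_le (a := n)))]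
  simp_rw [h _ _ (hu (Nat.le_succ _))]
  exact Finset.sum_range_sub (fun k => (Iic (u k)).indicator (fun _ => (1 : ℝ)) x) n

theorem exists_stepFunction_of_grid {F : ℝ → ℝ} {u : ℕ → ℝ} (hu : Monotone u) {n : ℕ} {ε : ℝ}
    (h : ∀ k < n, ∀ x ∈ Ioc (u k) (u (k + 1)), |F (u k) - F x| ≤ ε) :
    ∃ φ : StepFunction, ∀ x, |φ.toFun x - (Ioc (u 0) (u n)).indicator F x| ≤
      (Ioc (u 0) (u n)).indicator (fun _ => ε) x := by
  refine ⟨⟨n, fun i => F (u i), fun i => u i, fun i => u (i + 1), fun i => hu (Nat.le_succ _)⟩,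
    fun x => ?_⟩
  have e0 : ∀ c : ℝ, ∀ s : Set ℝ, s.indicator (fun _ => c) x = c * s.indicator (fun _ => 1) x := by
    intro c s; by_cases hx : x ∈ s <;> simp [hx]
  have e1 : (Ioc (u 0) (u n)).indicator F x =
      F x * (Ioc (u 0) (u n)).indicator (fun _ => 1) x := by
    by_cases hx : x ∈ Ioc (u 0) (u n) <;> simp [hx]
  rw [e1, e0 ε, ← sum_indicator_Ioc hu n x, StepFunction.toFun,
    Fin.sum_univ_eq_sum_range (fun k => (Ioc (u k) (u (k + 1))).indicator (fun _ => F (u k)) x) n,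
    Finset.mul_sum, Finset.mul_sum, ← Finset.sum_sub_distrib]
  refine (Finset.abs_sum_le_sum_abs _ _).trans (Finset.sum_le_sum fun k hk => ?_)
  by_cases hx : x ∈ Ioc (u k) (u (k + 1))
  · simpa [hx] using h k (Finset.mem_range.1 hk) x hx
  · simp [hx]

theorem exists_stepFunction_near {F : ℝ → ℝ} (hF : Continuous F) (N : ℕ) {ε : ℝ} (hε : 0 < ε) :
    ∃ φ : StepFunction, ∀ x, |φ.toFun x - (Ioc (-N : ℝ) N).indicator F x| ≤
      (Ioc (-N : ℝ) N).indicator (fun _ => ε) x := by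
  have huc := isCompact_Icc.uniformContinuousOn_of_continuous (s := Icc (-N : ℝ) N) hF.continuousOn
  obtain ⟨δ, hδ, h⟩ := Metric.uniformContinuousOn_iff.1 huc ε hε
  obtain ⟨M, hM⟩ := exists_nat_gt (2 * N / δ)
  have hM0 : (0 : ℝ) < M := lt_of_le_of_lt (by positivity) hM
  have hstep : 2 * N / (M : ℝ) < δ := by
    rw [div_lt_iff₀ hδ] at hM
    rw [div_lt_iff₀ hM0]; linarith
  -- The grid divides `[-N, N]` into `M` cells shorter than the modulus `δ` of uniform continuity.
  let u : ℕ → ℝ := fun k => -N + k * (2 * N / M)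
  have hu : Monotone u := by
    intro i j hij
    have : (i : ℝ) ≤ j := by exact_mod_cast hij
    simp only [u]
    gcongr
  have hu0 : u 0 = -N := by simp [u]
  have huM : u M = N := by simp only [u]; field_simp; ring
  have := exists_stepFunction_of_grid (F := F) hu (n := M) (ε := ε) (fun k hk x hx => ?_)
  · rwa [hu0, huM] at this
  · have hd : u (k + 1) - u k = 2 * N / M := by simp only [u]; push_cast; ring
    have h1 : -(N : ℝ) ≤ u k := hu0 ▸ hu (zero_le (a := k))
    have h2 : u (k + 1) ≤ N := huM ▸ hu (Nat.succ_le_of_lt hk)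
    refine (h (u k) ⟨h1, (hx.1.le.trans hx.2).trans h2⟩ x ⟨h1.trans hx.1.le, hx.2.trans h2⟩ ?_).le
    rw [dist_comm, Real.dist_eq, abs_of_pos (sub_pos.2 hx.1)]
    linarith [hx.2]

/-- This rests on `‖f‖₂² ≤ C ‖f‖₁` whenever `|f| ≤ C`. -/
theorem tendsto_eLpNorm_two_of_bounded {X : Type*} [MeasurableSpace X] {μ : Measure X}
    {f : ℕ → X → ℝ} {C : ℝ} (hC : ∀ n x, |f n x| ≤ C)
    (h : Tendsto (fun n => eLpNorm (f n) 1 μ) atTop (𝓝 0)) :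
    Tendsto (fun n => eLpNorm (f n) 2 μ) atTop (𝓝 0) := by
  have hb : ∀ n, eLpNorm (f n) 2 μ ^ 2 ≤ ENNReal.ofReal C * eLpNorm (f n) 1 μ := by
    intro n
    have e := eLpNorm_nnreal_pow_eq_lintegral (f := f n) (μ := μ) (p := 2) (by norm_num)
    have e2 : ((2 : ℝ≥0) : ℝ) = ((2 : ℕ) : ℝ) := by norm_num
    simp only [e2, ENNReal.rpow_natCast] at e
    have e' : eLpNorm (f n) 2 μ ^ 2 = ∫⁻ x, ‖f n x‖ₑ ^ 2 ∂μ := by exact_mod_cast e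
    rw [e', eLpNorm_one_eq_lintegral_enorm, ← lintegral_const_mul' _ _ ENNReal.ofReal_ne_top]
    refine lintegral_mono fun x => ?_
    rw [sq]
    gcongr
    rw [Real.enorm_eq_ofReal_abs]
    exact ENNReal.ofReal_le_ofReal (hC n x)
  have hlim := ENNReal.Tendsto.const_mul (a := ENNReal.ofReal C) h (Or.inr ENNReal.ofReal_ne_top)
  rw [mul_zero] at hlim
  have hsq := tendsto_of_tendsto_of_tendsto_of_le_of_le tendsto_const_nhds hlim
    (fun n => zero_le) hb
  have := (ENNReal.continuous_rpow_const (y := ((2 : ℕ) : ℝ)⁻¹)).tendsto 0 |>.comp hsq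
  rw [ENNReal.zero_rpow_of_pos (by norm_num)] at this
  exact (tendsto_congr fun n => ENNReal.pow_rpow_inv_natCast two_ne_zero _).1 this

/-- A bounded continuous integrable function is approximated by step functions, simultaneously in
`L¹` and in `L²`. -/
theorem exists_stepFunction_tendsto {F : ℝ → ℝ} (hF : Continuous F) (hF1 : Integrable F) {K : ℝ}
    (hK : ∀ x, |F x| ≤ K) :
    ∃ φ : ℕ → StepFunction,
      Tendsto (fun n => eLpNorm (fun x => (φ n).toFun x - F x) 1) atTop (𝓝 0) ∧
      Tendsto (fun n => eLpNorm (fun x => (φ n).toFun x - F x) 2) atTop (𝓝 0) := by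
  -- A uniform error `1 / (N + 1)²` on an interval of length `2 N` costs at most `2 / (N + 1)` in
  -- `L¹`; the tail of `F` is handled by dominated convergence.
  have hε : ∀ N : ℕ, (0 : ℝ) < 1 / ((N : ℝ) + 1) ^ 2 := fun N => by positivity
  choose φ hφ using fun N : ℕ => exists_stepFunction_near hF N (hε N)
  have h1 : Tendsto (fun n => eLpNorm (fun x => (φ n).toFun x - F x) 1) atTop (𝓝 0) := by
    have hb : ∀ N : ℕ, eLpNorm (fun x => (φ N).toFun x - F x) 1 ≤
        ENNReal.ofReal (2 * (1 / ((N : ℝ) + 1))) +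
          ∫⁻ x, ‖(Ioc (-N : ℝ) N).indicator F x - F x‖ₑ := by
      intro N
      rw [eLpNorm_one_eq_lintegral_enorm]
      calc ∫⁻ x, ‖(φ N).toFun x - F x‖ₑ
          ≤ ∫⁻ x, ((Ioc (-N : ℝ) N).indicator
              (fun _ => ENNReal.ofReal (1 / ((N : ℝ) + 1) ^ 2)) x +
              ‖(Ioc (-N : ℝ) N).indicator F x - F x‖ₑ) := by
            refine lintegral_mono fun x => ?_
            have e : (φ N).toFun x - F x = ((φ N).toFun x - (Ioc (-N : ℝ) N).indicator F x) +
              ((Ioc (-N : ℝ) N).indicator F x - F x) := by ring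
            simp only
            rw [e]
            refine (enorm_add_le _ _).trans ?_
            gcongr
            rw [Real.enorm_eq_ofReal_abs]
            refine (ENNReal.ofReal_le_ofReal (hφ N x)).trans (le_of_eq ?_)
            by_cases hx : x ∈ Ioc (-N : ℝ) N <;> simp [hx]
        _ = ENNReal.ofReal (1 / ((N : ℝ) + 1) ^ 2) * ENNReal.ofReal (N - -N) +
              ∫⁻ x, ‖(Ioc (-N : ℝ) N).indicator F x - F x‖ₑ := by
            rw [lintegral_add_left (measurable_const.indicator measurableSet_Ioc),
              lintegral_indicator_const measurableSet_Ioc, Real.volume_Ioc]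
        _ ≤ _ := by
            gcongr
            rw [← ENNReal.ofReal_mul (hε N).le]
            refine ENNReal.ofReal_le_ofReal ?_
            rw [one_div_mul_eq_div, mul_one_div, div_le_div_iff₀ (by positivity) (by positivity)]
            nlinarith [(Nat.cast_nonneg N : (0 : ℝ) ≤ N)]
    have l1 : Tendsto (fun N : ℕ => ENNReal.ofReal (2 * (1 / ((N : ℝ) + 1)))) atTop (𝓝 0) := by
      have := ENNReal.tendsto_ofReal
        ((tendsto_one_div_add_atTop_nhds_zero_nat (𝕜 := ℝ)).const_mul 2)
      simpa using this
    have l2 : Tendsto (fun N : ℕ => ∫⁻ x, ‖(Ioc (-N : ℝ) N).indicator F x - F x‖ₑ) atTop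
        (𝓝 0) := by
      have := tendsto_lintegral_of_dominated_convergence (μ := volume)
        (F := fun (N : ℕ) x => ‖(Ioc (-N : ℝ) N).indicator F x - F x‖ₑ) (f := fun _ => 0)
        (fun x => ‖F x‖ₑ) (fun N => ?_) (fun N => ae_of_all _ fun x => ?_) hF1.2.ne
        (ae_of_all _ fun x => ?_)
      · simpa using this
      · exact (((hF.measurable.indicator measurableSet_Ioc).sub hF.measurable).enorm)
      · by_cases hx : x ∈ Ioc (-N : ℝ) N <;> simp [hx]
      · obtain ⟨n, hn⟩ := exists_nat_gt |x|
        refine tendsto_const_nhds.congr' ?_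
        filter_upwards [eventually_ge_atTop n] with N hN
        have hnN : (n : ℝ) ≤ N := by exact_mod_cast hN
        have hx : x ∈ Ioc (-N : ℝ) N := by
          constructor <;> linarith [abs_lt.1 hn, neg_abs_le x, le_abs_self x]
        simp [hx]
    have l12 := l1.add l2
    rw [add_zero] at l12
    exact tendsto_of_tendsto_of_tendsto_of_le_of_le tendsto_const_nhds l12
      (fun n => zero_le) hb
  refine ⟨φ, h1, tendsto_eLpNorm_two_of_bounded (C := K + 1) (fun N x => ?_) h1⟩
  have hN : 1 / ((N : ℝ) + 1) ^ 2 ≤ 1 := by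
    rw [div_le_one (by positivity)]
    nlinarith [(Nat.cast_nonneg N : (0 : ℝ) ≤ N)]
  have h := hφ N x
  have hKx := hK x
  by_cases hx : x ∈ Ioc (-N : ℝ) N
  · rw [indicator_of_mem hx, indicator_of_mem hx] at h
    linarith [abs_nonneg (F x)]
  · rw [indicator_of_notMem hx, indicator_of_notMem hx] at h
    have e : (φ N).toFun x = 0 := by simpa using h
    rw [e, zero_sub, abs_neg]; linarith

/-! ### The kernel as a mixture of intervals -/

/-- The measure `d (d - 1) (w + a)^(d - 2) dw` on `(0, ∞)`. -/
def lagMeasure (a d : ℝ) : Measure ℝ :=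
  (volume.restrict (Ioi 0)).withDensity fun w => ENNReal.ofReal (d * (d - 1) * (w + a) ^ (d - 2))

/-- The mixture of the intervals `(r - w, r]`, with `r` uniform on `(s, t]` and `w` distributed
according to `lagMeasure a d`. -/
def lagIntervals (a d s t : ℝ) : Measure (ℝ × ℝ) :=
  ((volume.restrict (Ioc s t)).prod (lagMeasure a d)).map fun p => (p.1 - p.2, p.1)

instance (a d : ℝ) : SFinite (lagMeasure a d) := by unfold lagMeasure; infer_instance

instance (a d s t : ℝ) : SFinite (lagIntervals a d s t) := by unfold lagIntervals; infer_instance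

theorem lintegral_lagIntervals (a d s t : ℝ) {f : ℝ × ℝ → ℝ≥0∞} (hf : Measurable f) :
    ∫⁻ z, f z ∂(lagIntervals a d s t) =
      ∫⁻ r in Ioc s t, ∫⁻ w, f (r - w, r) ∂(lagMeasure a d) := by
  have hg : Measurable fun p : ℝ × ℝ => (p.1 - p.2, p.1) := by fun_prop
  rw [lagIntervals, lintegral_map hf hg]
  exact lintegral_prod _ (hf.comp hg).aemeasurable

/-- The density is the second derivative of `g w = (w + a)^d`, so the tail beyond `c` is `-g' c`;
integrating this once more yields the differences of powers in the kernel. -/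
theorem lagMeasure_Ioi {a d c : ℝ} (ha : 0 < a) (hd : d < 0) (hc : 0 ≤ c) :
    lagMeasure a d (Ioi c) = ENNReal.ofReal (-d * (c + a) ^ (d - 1)) := by
  have hmeas : Measurable fun w : ℝ => ENNReal.ofReal (d * (d - 1) * (w + a) ^ (d - 2)) := by
    fun_prop
  rw [lagMeasure, withDensity_apply _ measurableSet_Ioi, Measure.restrict_restrict measurableSet_Ioi,
    Ioi_inter_Ioi, max_eq_left hc]
  have hderiv : ∀ x ∈ Ici c,
      HasDerivAt (fun w => d * (w + a) ^ (d - 1)) (d * (d - 1) * (x + a) ^ (d - 2)) x := by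
    intro x hx
    have hx' : c ≤ x := hx
    have hne : x + a ≠ 0 := by linarith
    have h := (((hasDerivAt_id x).add_const a).rpow_const (p := d - 1)
      (Or.inl hne)).const_mul d
    refine h.congr_deriv ?_
    rw [show d - 1 - 1 = d - 2 by ring, id]
    ring
  have hpos : ∀ x ∈ Ioi c, 0 ≤ d * (d - 1) * (x + a) ^ (d - 2) := by
    intro x hx
    have hx' : c < x := hx
    have : 0 ≤ (x + a) ^ (d - 2) := Real.rpow_nonneg (by linarith) _
    exact mul_nonneg (mul_nonneg_of_nonpos_of_nonpos hd.le (by linarith)) this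
  have hlim : Tendsto (fun w => d * (w + a) ^ (d - 1)) atTop (𝓝 0) := by
    have h := ((tendsto_rpow_neg_atTop (y := 1 - d) (by linarith)).comp
      (tendsto_atTop_add_const_right _ a tendsto_id)).const_mul d
    simpa [Function.comp_def] using h
  rw [← ofReal_integral_eq_lintegral_ofReal (integrableOn_Ioi_deriv_of_nonneg' hderiv hpos hlim)
    ((ae_restrict_iff' measurableSet_Ioi).2 (ae_of_all _ hpos)),
    integral_Ioi_of_hasDerivAt_of_nonneg' hderiv hpos hlim]
  congr 1
  ring

/-- Since `w (w + a)^(d - 2) ≤ (w + a)^(d - 1)`, the mean lag is finite because `d - 1 < -1`. -/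
theorem lintegral_lagMeasure_lt_top {a d : ℝ} (ha : 0 < a) (hd : d < 0) :
    ∫⁻ w, ENNReal.ofReal w ∂(lagMeasure a d) < ∞ := by
  have hmeas : Measurable fun w : ℝ => ENNReal.ofReal (d * (d - 1) * (w + a) ^ (d - 2)) := by
    fun_prop
  rw [lagMeasure, lintegral_withDensity_eq_lintegral_mul _ hmeas ENNReal.measurable_ofReal]
  have hint : IntegrableOn (fun w : ℝ => d * (d - 1) * (w + a) ^ (d - 1)) (Ioi 0) :=
    (integrableOn_add_rpow_Ioi_of_lt (by linarith) (by linarith)).const_mul _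
  refine lt_of_le_of_lt ?_ hint.lintegral_lt_top
  refine setLIntegral_mono (by fun_prop) fun w hw => ?_
  have hw' : 0 < w := hw
  have h1 : 0 ≤ (w + a) ^ (d - 2) := Real.rpow_nonneg (by linarith) _
  have h2 : (w + a) ^ (d - 1) = (w + a) ^ (d - 2) * (w + a) := by
    rw [← Real.rpow_add_one (by linarith)]; congr 1; ring
  have h3 : 0 ≤ d * (d - 1) := mul_nonneg_of_nonpos_of_nonpos hd.le (by linarith)
  simp only [Pi.mul_apply]
  rw [← ENNReal.ofReal_mul (mul_nonneg h3 h1), h2]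
  refine ENNReal.ofReal_le_ofReal ?_
  rw [mul_assoc]
  gcongr
  linarith

/-- The shifted one-sided power `x ↦ (a + (t - x)₊)^d`. -/
def shiftedPower (a d t x : ℝ) : ℝ := (a + max (t - x) 0) ^ d

theorem modMvNKernel_eq (a d t x : ℝ) :
    modMvNKernel a d t x = shiftedPower a d 0 x - shiftedPower a d t x := by
  simp [modMvNKernel, shiftedPower]

theorem shiftedPower_nonneg {a : ℝ} (ha : 0 < a) (d t x : ℝ) : 0 ≤ shiftedPower a d t x :=
  Real.rpow_nonneg (by positivity) _

theorem shiftedPower_le {a d : ℝ} (ha : 0 < a) (hd : d < 0) (t x : ℝ) :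
    shiftedPower a d t x ≤ a ^ d :=
  Real.rpow_le_rpow_of_nonpos ha (by simp) hd.le

theorem shiftedPower_antitone {a d : ℝ} (ha : 0 < a) (hd : d < 0) (x : ℝ) :
    Antitone fun t => shiftedPower a d t x := fun s t hst =>
  Real.rpow_le_rpow_of_nonpos (by positivity) (by gcongr) hd.le

theorem continuous_shiftedPower {a : ℝ} (ha : 0 < a) (d t : ℝ) :
    Continuous (shiftedPower a d t) := by
  have h : Continuous fun x : ℝ => a + max (t - x) 0 := by fun_prop
  exact h.rpow_const fun x => Or.inl (by positivity)

/-- A point `x` lies in `(r - w, r]` exactly when `r ≥ x` and `w > r - x`. The lags therefore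
contribute the tail `-d (r - x + a)^(d - 1)`, whose integral over `r` from `max s x` to `t` is
elementary. -/
theorem overlap_lagIntervals {a d s t : ℝ} (ha : 0 < a) (hd : d < 0) (hst : s ≤ t) (x : ℝ) :
    overlap (lagIntervals a d s t) x =
      ENNReal.ofReal (shiftedPower a d s x - shiftedPower a d t x) := by
  have hm : Measurable fun z : ℝ × ℝ => (Ioc z.1 z.2).indicator (1 : ℝ → ℝ≥0∞) x :=
    measurable_indicator_Ioc.comp measurable_prodMk_left
  rw [overlap, lintegral_lagIntervals a d s t hm]
  have inner : ∀ r, ∫⁻ w, (Ioc (r - w) r).indicator (1 : ℝ → ℝ≥0∞) x ∂(lagMeasure a d) =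
      (Ici x).indicator (fun r => ENNReal.ofReal (-d * (r - x + a) ^ (d - 1))) r := by
    intro r
    by_cases hx : x ≤ r
    · have e : ∀ w, (Ioc (r - w) r).indicator (1 : ℝ → ℝ≥0∞) x = (Ioi (r - x)).indicator 1 w := by
        intro w
        simp only [indicator_apply, mem_Ioc, mem_Ioi, Pi.one_apply]
        congr 1
        simp only [eq_iff_iff]
        constructor
        · rintro ⟨h, -⟩; linarith
        · intro h; exact ⟨by linarith, hx⟩
      simp_rw [e]
      rw [lintegral_indicator_one measurableSet_Ioi, lagMeasure_Ioi ha hd (by linarith),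
        indicator_of_mem (mem_Ici.2 hx)]
    · have e : ∀ w, (Ioc (r - w) r).indicator (1 : ℝ → ℝ≥0∞) x = 0 := by
        intro w
        exact indicator_of_notMem (fun h => hx h.2) _
      simp_rw [e]
      rw [lintegral_zero, indicator_of_notMem (by simpa using hx)]
  simp_rw [inner]
  rw [lintegral_indicator measurableSet_Ici, Measure.restrict_restrict measurableSet_Ici]
  rcases le_or_gt t x with htx | htx
  · have h0 : volume (Ici x ∩ Ioc s t) = 0 := by
      refine measure_mono_null (t := {t}) (fun r hr => ?_) (by simp)
      exact le_antisymm hr.2.2 (htx.trans hr.1)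
    rw [Measure.restrict_eq_zero.2 h0, lintegral_zero_measure, shiftedPower, shiftedPower,
      max_eq_right (by linarith), max_eq_right (by linarith), sub_self, ENNReal.ofReal_zero]
  · set b := max s x with hb
    have hbt : b ≤ t := max_le hst htx.le
    have hxb : x ≤ b := le_max_right _ _
    have hset : (Ici x ∩ Ioc s t : Set ℝ) =ᵐ[volume] Ioc b t := by
      have h1 : (Ici x ∩ Ioc s t : Set ℝ) =ᵐ[volume] (Ioi x ∩ Ioc s t : Set ℝ) :=
        Ioi_ae_eq_Ici.symm.inter (ae_eq_refl _)
      have h2 : Ioi x ∩ Ioc s t = Ioc b t := by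
        ext r; simp only [mem_inter_iff, mem_Ioi, mem_Ioc, hb, max_lt_iff]; tauto
      rwa [h2] at h1
    rw [setLIntegral_congr hset]
    have hpos : ∀ r ∈ Ioc b t, 0 ≤ -d * (r - x + a) ^ (d - 1) := fun r hr =>
      mul_nonneg (by linarith) (Real.rpow_nonneg (by linarith [hr.1]) _)
    have hcont : ContinuousOn (fun r => -d * (r - x + a) ^ (d - 1)) (Icc b t) := by
      refine ContinuousOn.const_mul (ContinuousOn.rpow_const (by fun_prop) fun r hr => Or.inl ?_) _
      linarith [hr.1]
    have hint : IntegrableOn (fun r => -d * (r - x + a) ^ (d - 1)) (Ioc b t) :=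
      hcont.integrableOn_Icc.mono_set Ioc_subset_Icc_self
    rw [← ofReal_integral_eq_lintegral_ofReal hint
      ((ae_restrict_iff' measurableSet_Ioc).2 (ae_of_all _ hpos)),
      ← intervalIntegral.integral_of_le hbt]
    have hderiv : ∀ r ∈ uIcc b t,
        HasDerivAt (fun r => -(r - x + a) ^ d) (-d * (r - x + a) ^ (d - 1)) r := by
      intro r hr
      rw [uIcc_of_le hbt] at hr
      have hne : r - x + a ≠ 0 := by linarith [hr.1]
      have h := ((((hasDerivAt_id r).sub_const x).add_const a).rpow_const (p := d)
        (Or.inl hne)).neg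
      refine h.congr_deriv ?_
      rw [id]
      ring
    rw [intervalIntegral.integral_eq_sub_of_hasDerivAt hderiv
      (intervalIntegrable_iff_integrableOn_Ioc_of_le hbt |>.2 hint), shiftedPower, shiftedPower,
      max_eq_left (by linarith : 0 ≤ t - x)]
    have e : max (s - x) 0 = b - x := by
      rw [hb, ← max_sub_sub_right s x x, sub_self]
    rw [e]
    congr 1
    rw [add_comm a, add_comm a]
    ring

theorem abs_shiftedPower_sub_le {a d : ℝ} (ha : 0 < a) (hd : d < 0) (s t x : ℝ) :
    |shiftedPower a d s x - shiftedPower a d t x| ≤ a ^ d := by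
  have h1 := shiftedPower_nonneg ha d s x
  have h2 := shiftedPower_nonneg ha d t x
  have h3 := shiftedPower_le ha hd s x
  have h4 := shiftedPower_le ha hd t x
  rw [abs_le]; constructor <;> linarith

/-- By Tonelli the integral equals the total length of the mixed intervals, which is `t - s` times
the finite mean lag. -/
theorem integrable_shiftedPower_sub {a d s t : ℝ} (ha : 0 < a) (hd : d < 0) (hst : s ≤ t) :
    Integrable fun x => shiftedPower a d s x - shiftedPower a d t x := by
  have hc : Continuous fun x => shiftedPower a d s x - shiftedPower a d t x :=
    (continuous_shiftedPower ha d s).sub (continuous_shiftedPower ha d t)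
  refine ⟨hc.aestronglyMeasurable, ?_⟩
  rw [hasFiniteIntegral_iff_ofReal
    (ae_of_all _ fun x => sub_nonneg.2 (shiftedPower_antitone ha hd x hst))]
  simp_rw [← overlap_lagIntervals ha hd hst]
  have hvol : Measurable fun z : ℝ × ℝ => volume (Ioc z.1 z.2) := by
    simp_rw [Real.volume_Ioc]; fun_prop
  rw [lintegral_overlap, lintegral_lagIntervals a d s t hvol]
  simp_rw [Real.volume_Ioc, sub_sub_cancel]
  rw [setLIntegral_const]
  exact ENNReal.mul_lt_top (lintegral_lagMeasure_lt_top ha hd) (by simp)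

theorem memLp_shiftedPower_sub {a d s t : ℝ} (ha : 0 < a) (hd : d < 0) (hst : s ≤ t) :
    MemLp (fun x => shiftedPower a d s x - shiftedPower a d t x) 2 := by
  have hc : Continuous fun x => shiftedPower a d s x - shiftedPower a d t x :=
    (continuous_shiftedPower ha d s).sub (continuous_shiftedPower ha d t)
  rw [memLp_two_iff_integrable_sq hc.aestronglyMeasurable]
  refine ((integrable_shiftedPower_sub ha hd hst).const_mul (a ^ d)).mono
    (hc.pow 2).aestronglyMeasurable (ae_of_all _ fun x => ?_)
  have h := abs_shiftedPower_sub_le ha hd s t x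
  rw [norm_pow, norm_mul, sq, Real.norm_of_nonneg (Real.rpow_nonneg ha.le d), Real.norm_eq_abs]
  exact mul_le_mul_of_nonneg_right h (abs_nonneg _)

/-! ### The pathwise construction of the fractional subordinator -/

section

variable {Ω : Type*}

/-- The density `r ↦ ∫_0^∞ (T r - T (r - w)) d (d - 1) (w + a)^(d - 2) dw` of the fractional
subordinator driven by `T`. -/
def fractionalDensity (a d : ℝ) (T : ℝ → Ω → ℝ) (r : ℝ) (ω : Ω) : ℝ≥0∞ :=
  ∫⁻ w, ENNReal.ofReal (T r ω - T (r - w) ω) ∂(lagMeasure a d)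

/-- The paths along which the fractional density is locally integrable. -/
def finiteDensitySet (a d : ℝ) (T : ℝ → Ω → ℝ) : Set Ω :=
  {ω | ∀ n : ℕ, incrementIntegral T (lagIntervals a d (-n) n) ω < ∞}

open Classical in
/-- The fractional subordinator driven by `T`. -/
def fractionalPath (a d : ℝ) (T : ℝ → Ω → ℝ) (t : ℝ) (ω : Ω) : ℝ :=
  if ω ∈ finiteDensitySet a d T then ∫ r in 0..t, (fractionalDensity a d T r ω).toReal else 0

variable {a d : ℝ} {T : ℝ → Ω → ℝ}

theorem incrementIntegral_lagIntervals (hmono : ∀ ω, Monotone fun t => T t ω) (s t : ℝ) (ω : Ω) :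
    incrementIntegral T (lagIntervals a d s t) ω =
      ∫⁻ r in Ioc s t, fractionalDensity a d T r ω := by
  have hT : Measurable fun t => T t ω := (hmono ω).measurable
  have hm : Measurable fun z : ℝ × ℝ => ENNReal.ofReal (T z.2 ω - T z.1 ω) :=
    ENNReal.measurable_ofReal.comp ((hT.comp measurable_snd).sub (hT.comp measurable_fst))
  rw [incrementIntegral, lintegral_lagIntervals a d s t hm]
  rfl

theorem measurable_fractionalDensity (hmono : ∀ ω, Monotone fun t => T t ω) (ω : Ω) :
    Measurable fun r => fractionalDensity a d T r ω := by
  have hT : Measurable fun t => T t ω := (hmono ω).measurable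
  refine Measurable.lintegral_prod_right'
    (f := fun p : ℝ × ℝ => ENNReal.ofReal (T p.1 ω - T (p.1 - p.2) ω)) ?_
  exact ENNReal.measurable_ofReal.comp ((hT.comp measurable_fst).sub
    (hT.comp (measurable_fst.sub measurable_snd)))

theorem lintegral_fractionalDensity_lt_top (hmono : ∀ ω, Monotone fun t => T t ω) {ω : Ω}
    (hω : ω ∈ finiteDensitySet a d T) (s t : ℝ) :
    ∫⁻ r in Ioc s t, fractionalDensity a d T r ω < ∞ := by
  obtain ⟨n, hn⟩ := exists_nat_ge (max (-s) t)
  have h := hω n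
  rw [incrementIntegral_lagIntervals hmono] at h
  refine lt_of_le_of_lt (lintegral_mono_set (Ioc_subset_Ioc ?_ ?_)) h
  · linarith [le_max_left (-s) t]
  · linarith [le_max_right (-s) t]

theorem intervalIntegrable_fractionalDensity (hmono : ∀ ω, Monotone fun t => T t ω) {ω : Ω}
    (hω : ω ∈ finiteDensitySet a d T) (s t : ℝ) :
    IntervalIntegrable (fun r => (fractionalDensity a d T r ω).toReal) volume s t :=
  ⟨integrable_toReal_of_lintegral_ne_top (measurable_fractionalDensity hmono ω).aemeasurable
      (lintegral_fractionalDensity_lt_top hmono hω s t).ne,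
    integrable_toReal_of_lintegral_ne_top (measurable_fractionalDensity hmono ω).aemeasurable
      (lintegral_fractionalDensity_lt_top hmono hω t s).ne⟩

theorem intervalIntegral_fractionalDensity (hmono : ∀ ω, Monotone fun t => T t ω) {ω : Ω}
    (hω : ω ∈ finiteDensitySet a d T) {s t : ℝ} (hst : s ≤ t) :
    ∫ r in s..t, (fractionalDensity a d T r ω).toReal =
      (incrementIntegral T (lagIntervals a d s t) ω).toReal := by
  rw [intervalIntegral.integral_of_le hst, incrementIntegral_lagIntervals hmono,
    integral_toReal (measurable_fractionalDensity hmono ω).aemeasurable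
      (ae_lt_top (measurable_fractionalDensity hmono ω)
        (lintegral_fractionalDensity_lt_top hmono hω s t).ne)]

theorem fractionalPath_of_nonneg (hmono : ∀ ω, Monotone fun t => T t ω) {t : ℝ} (ht : 0 ≤ t) :
    fractionalPath a d T t = (finiteDensitySet a d T).indicator
      fun ω => (incrementIntegral T (lagIntervals a d 0 t) ω).toReal := by
  ext ω
  by_cases hω : ω ∈ finiteDensitySet a d T
  · rw [fractionalPath, if_pos hω, indicator_of_mem hω,
      intervalIntegral_fractionalDensity hmono hω ht]
  · rw [fractionalPath, if_neg hω, indicator_of_notMem hω]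

theorem fractionalPath_of_nonpos (hmono : ∀ ω, Monotone fun t => T t ω) {t : ℝ} (ht : t ≤ 0) :
    fractionalPath a d T t = (finiteDensitySet a d T).indicator
      fun ω => -(incrementIntegral T (lagIntervals a d t 0) ω).toReal := by
  ext ω
  by_cases hω : ω ∈ finiteDensitySet a d T
  · rw [fractionalPath, if_pos hω, indicator_of_mem hω, intervalIntegral.integral_symm,
      intervalIntegral_fractionalDensity hmono hω ht]
  · rw [fractionalPath, if_neg hω, indicator_of_notMem hω]

theorem fractionalPath_zero (ω : Ω) : fractionalPath a d T 0 ω = 0 := by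
  simp [fractionalPath]

theorem fractionalPath_sub (hmono : ∀ ω, Monotone fun t => T t ω) {ω : Ω}
    (hω : ω ∈ finiteDensitySet a d T) (s t : ℝ) :
    fractionalPath a d T t ω - fractionalPath a d T s ω =
      ∫ r in s..t, (fractionalDensity a d T r ω).toReal := by
  rw [fractionalPath, fractionalPath, if_pos hω, if_pos hω,
    intervalIntegral.integral_interval_sub_left (intervalIntegrable_fractionalDensity hmono hω _ _)
      (intervalIntegrable_fractionalDensity hmono hω _ _)]

theorem continuous_fractionalPath (hmono : ∀ ω, Monotone fun t => T t ω) (ω : Ω) :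
    Continuous fun t => fractionalPath a d T t ω := by
  by_cases hω : ω ∈ finiteDensitySet a d T
  · simp only [fractionalPath, if_pos hω]
    exact intervalIntegral.continuous_primitive (intervalIntegrable_fractionalDensity hmono hω) 0
  · simp only [fractionalPath, if_neg hω]
    exact continuous_const

theorem monotone_fractionalPath (hmono : ∀ ω, Monotone fun t => T t ω) (ω : Ω) :
    Monotone fun t => fractionalPath a d T t ω := by
  by_cases hω : ω ∈ finiteDensitySet a d T
  · intro s t hst
    refine sub_nonneg.1 ?_
    rw [fractionalPath_sub hmono hω]
    exact intervalIntegral.integral_nonneg hst fun _ _ => ENNReal.toReal_nonneg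
  · simp only [fractionalPath, if_neg hω]
    exact monotone_const

/-- For `r ≥ 0` every lag `w > r - u` reaches back before `u`, so that `T r - T (r - w) ≥ T 0 - T u
> 0`. These lags have positive mass, hence the density is positive at every `r ≥ 0`. -/
theorem strictMonoOn_fractionalPath (ha : 0 < a) (hd : d < 0)
    (hmono : ∀ ω, Monotone fun t => T t ω) {ω : Ω} (hω : ω ∈ finiteDensitySet a d T) {u : ℝ}
    (hu : T u ω < T 0 ω) : StrictMonoOn (fun t => fractionalPath a d T t ω) (Ici 0) := by
  have hpos : ∀ r, 0 ≤ r → 0 < fractionalDensity a d T r ω := by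
    intro r hr
    have hT : Measurable fun t => T t ω := (hmono ω).measurable
    have hm : Measurable fun w => ENNReal.ofReal (T r ω - T (r - w) ω) :=
      ENNReal.measurable_ofReal.comp
        (measurable_const.sub (hT.comp (measurable_const.sub measurable_id)))
    have hu0 : u < 0 := by
      by_contra h
      exact absurd (hmono ω (not_lt.1 h)) (not_le.2 hu)
    rw [fractionalDensity, lintegral_pos_iff_support hm]
    have hsub : Ioi (r - u) ⊆ Function.support fun w => ENNReal.ofReal (T r ω - T (r - w) ω) := by
      intro w hw
      have hw' : r - w ≤ u := by have : r - u < w := hw; linarith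
      have h1 : T (r - w) ω ≤ T u ω := hmono ω hw'
      have h2 : T 0 ω ≤ T r ω := hmono ω hr
      exact (ENNReal.ofReal_pos.2 (by linarith)).ne'
    refine lt_of_lt_of_le ?_ (measure_mono hsub)
    rw [lagMeasure_Ioi ha hd (by linarith)]
    exact ENNReal.ofReal_pos.2 (mul_pos (by linarith) (Real.rpow_pos_of_pos (by linarith) _))
  intro s hs t ht hst
  refine sub_pos.1 ?_
  rw [fractionalPath_sub hmono hω, intervalIntegral_fractionalDensity hmono hω hst.le,
    incrementIntegral_lagIntervals hmono]
  refine ENNReal.toReal_pos (ne_of_gt ?_) (lintegral_fractionalDensity_lt_top hmono hω s t).ne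
  rw [setLIntegral_pos_iff (measurable_fractionalDensity hmono ω)]
  have hs0 : (0 : ℝ) ≤ s := hs
  have hsub : Ioc s t ⊆ (Function.support fun r => fractionalDensity a d T r ω) ∩ Ioc s t :=
    fun r hr => ⟨(hpos r (hs0.trans hr.1.le)).ne', hr⟩
  refine lt_of_lt_of_le ?_ (measure_mono hsub)
  rw [Real.volume_Ioc]
  exact ENNReal.ofReal_pos.2 (by linarith)

theorem ae_lagMeasure_pos (a d : ℝ) : ∀ᵐ w ∂(lagMeasure a d), 0 < w :=
  (withDensity_absolutelyContinuous _ _).ae_le (ae_restrict_mem measurableSet_Ioi)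

/-- This is adaptedness, with `m` in the role of `𝓕_t`. The finiteness set involves later times, so
its measurability is a separate hypothesis, to be met through the null sets of the filtration. -/
theorem measurable_fractionalPath_of_le {m : MeasurableSpace Ω}
    (hmono : ∀ ω, Monotone fun t => T t ω)
    (hright : ∀ ω t, ContinuousWithinAt (fun s => T s ω) (Ici t) t) {t : ℝ} (ht : 0 ≤ t)
    (hT : ∀ u ≤ t, Measurable (T u)) (hfin : MeasurableSet (finiteDensitySet a d T)) :
    Measurable (fractionalPath a d T t) := by
  rw [fractionalPath_of_nonneg hmono ht]
  refine Measurable.indicator ?_ hfin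
  -- All intervals `(r - w, r]` in play end before or at `t`, so freezing the path after `t` changes
  -- nothing and leaves a process that is jointly measurable for `m`.
  have hclip : incrementIntegral T (lagIntervals a d 0 t) =
      incrementIntegral (fun u ω => T (min u t) ω) (lagIntervals a d 0 t) := by
    ext ω
    rw [incrementIntegral_lagIntervals hmono, incrementIntegral_lagIntervals
      (fun ω u v huv => hmono ω (min_le_min_right t huv))]
    refine setLIntegral_congr_fun measurableSet_Ioc fun r hr => lintegral_congr_ae ?_
    filter_upwards [ae_lagMeasure_pos a d] with w hw
    rw [min_eq_left hr.2, min_eq_left (by linarith [hr.2])]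
  rw [hclip]
  refine (measurable_incrementIntegral ?_ _).ennreal_toReal
  refine measurable_uncurry_of_rightContinuous (Z := fun u ω => T (min u t) ω) 
    (fun u => hT _ (min_le_right _ _)) fun ω u => ?_
  have hmin : ContinuousWithinAt (fun s : ℝ => min s t) (Ici u) u :=
    (continuous_id.min continuous_const).continuousWithinAt
  exact (hright ω (min u t)).comp (f := fun s : ℝ => min s t) hmin
    fun s hs => min_le_min_right t hs

end

/-! ### Identification of the pathwise process with the stochastic integral -/

section

variable {Ω : Type*} [MeasurableSpace Ω] {P : Measure Ω} [IsProbabilityMeasure P]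
  {a d m v : ℝ} {T : ℝ → Ω → ℝ}

theorem measurableSet_finiteDensitySet (hT : Measurable fun p : ℝ × Ω => T p.1 p.2) :
    MeasurableSet (finiteDensitySet a d T) := by
  rw [finiteDensitySet, ofPred_forall]
  exact MeasurableSet.iInter fun n =>
    measurableSet_lt (measurable_incrementIntegral hT _) measurable_const

theorem HasLinearMoments.ae_mem_finiteDensitySet (h : HasLinearMoments P T m v) (hv : 0 ≤ v)
    (hmono : ∀ ω, Monotone fun t => T t ω) (hT : Measurable fun p : ℝ × Ω => T p.1 p.2)
    (ha : 0 < a) (hd : d < 0) : ∀ᵐ ω ∂P, ω ∈ finiteDensitySet a d T := by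
  refine ae_all_iff.2 fun n => ?_
  have hn : (-n : ℝ) ≤ n := by linarith [(Nat.cast_nonneg n : (0 : ℝ) ≤ n)]
  exact h.ae_incrementIntegral_lt_top hv hmono hT (overlap_lagIntervals ha hd hn)
    (fun x => sub_nonneg.2 (shiftedPower_antitone ha hd x hn)) (integrable_shiftedPower_sub ha hd hn)
    (memLp_shiftedPower_sub ha hd hn)

/-- Convergence is stated for every approximating sequence, because the uniqueness argument has to
use the sequence that comes with another version. -/
theorem HasLinearMoments.fractionalPath_spec (h : HasLinearMoments P T m v) (hv : 0 ≤ v)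
    (hmono : ∀ ω, Monotone fun t => T t ω) (hT : Measurable fun p : ℝ × Ω => T p.1 p.2)
    (ha : 0 < a) (hd : d < 0) (t : ℝ) :
    MemLp (fractionalPath a d T t) 2 P ∧ ∀ φ : ℕ → StepFunction,
      Tendsto (fun n => eLpNorm (fun x => (φ n).toFun x - modMvNKernel a d t x) 1) atTop (𝓝 0) →
      Tendsto (fun n => eLpNorm (fun x => (φ n).toFun x - modMvNKernel a d t x) 2) atTop (𝓝 0) →
      Tendsto (fun n => eLpNorm (fun ω => (φ n).integral T ω - fractionalPath a d T t ω) 2 P)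
        atTop (𝓝 0) := by
  have hae := h.ae_mem_finiteDensitySet hv hmono hT ha hd
  -- The sign `c = ±1` treats both half-lines at once: for `t ≤ 0` the kernel is minus the mixture
  -- over `(t, 0]`.
  obtain ⟨s, t', c, hst, hker, hY⟩ : ∃ s t' c : ℝ, s ≤ t' ∧
      (∀ x, modMvNKernel a d t x = c * (shiftedPower a d s x - shiftedPower a d t' x)) ∧
      fractionalPath a d T t =ᵐ[P]
        fun ω => c * (incrementIntegral T (lagIntervals a d s t') ω).toReal := by
    rcases le_total 0 t with ht | ht
    · refine ⟨0, t, 1, ht, fun x => by rw [modMvNKernel_eq, one_mul], ?_⟩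
      filter_upwards [hae] with ω hω
      rw [fractionalPath_of_nonneg hmono ht, indicator_of_mem hω, one_mul]
    · refine ⟨t, 0, -1, ht, fun x => by rw [modMvNKernel_eq]; ring, ?_⟩
      filter_upwards [hae] with ω hω
      rw [fractionalPath_of_nonpos hmono ht, indicator_of_mem hω, neg_one_mul]
  have F0 : ∀ x, 0 ≤ shiftedPower a d s x - shiftedPower a d t' x :=
    fun x => sub_nonneg.2 (shiftedPower_antitone ha hd x hst)
  have F1 := integrable_shiftedPower_sub ha hd hst
  have F2 := memLp_shiftedPower_sub ha hd hst
  have hov := overlap_lagIntervals ha hd hst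
  refine ⟨(memLp_congr_ae hY).2
    ((h.memLp_incrementIntegral hv hmono hT hov F0 F1 F2).const_mul c), fun φ h1 h2 => ?_⟩
  simp_rw [hker] at h1 h2
  refine (tendsto_congr fun n => eLpNorm_congr_ae ?_).1
    (h.tendsto_integral_step hv hmono hT hov F0 F1 F2 φ c h1 h2)
  filter_upwards [hY] with ω hω
  rw [hω]

theorem exists_stepFunction_tendsto_modMvNKernel (ha : 0 < a) (hd : d < 0) (t : ℝ) :
    ∃ φ : ℕ → StepFunction,
      Tendsto (fun n => eLpNorm (fun x => (φ n).toFun x - modMvNKernel a d t x) 1) atTop (𝓝 0) ∧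
      Tendsto (fun n => eLpNorm (fun x => (φ n).toFun x - modMvNKernel a d t x) 2) atTop
        (𝓝 0) := by
  have hker := funext (modMvNKernel_eq a d t)
  refine exists_stepFunction_tendsto (K := a ^ d) ?_ ?_ fun x => ?_
  · rw [hker]
    exact (continuous_shiftedPower ha d 0).sub (continuous_shiftedPower ha d t)
  · rw [hker]
    rcases le_total 0 t with ht | ht
    · exact integrable_shiftedPower_sub ha hd ht
    · refine (integrable_shiftedPower_sub ha hd ht).neg.congr (ae_of_all _ fun x => ?_)
      simp
  · rw [hker]
    exact abs_shiftedPower_sub_le ha hd 0 t x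

variable {S : ℝ → Ω → ℝ}

omit [IsProbabilityMeasure P] in
theorem integral_ae_eq_of_forall_ae_eq (hST : ∀ t, S t =ᵐ[P] T t) (φ : StepFunction) :
    φ.integral S =ᵐ[P] φ.integral T := by
  have hl : ∀ᵐ ω ∂P, ∀ i, S (φ.left i) ω = T (φ.left i) ω := ae_all_iff.2 fun i => hST _
  have hr : ∀ᵐ ω ∂P, ∀ i, S (φ.right i) ω = T (φ.right i) ω := ae_all_iff.2 fun i => hST _
  filter_upwards [hl, hr] with ω hl hr
  simp only [StepFunction.integral, hl, hr]

theorem HasLinearMoments.tendsto_fractionalPath (h : HasLinearMoments P T m v) (hv : 0 ≤ v)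
    (hmono : ∀ ω, Monotone fun t => T t ω) (hT : Measurable fun p : ℝ × Ω => T p.1 p.2)
    (ha : 0 < a) (hd : d < 0) (hST : ∀ t, S t =ᵐ[P] T t) (t : ℝ) (φ : ℕ → StepFunction)
    (h1 : Tendsto (fun n => eLpNorm (fun x => (φ n).toFun x - modMvNKernel a d t x) 1) atTop
      (𝓝 0))
    (h2 : Tendsto (fun n => eLpNorm (fun x => (φ n).toFun x - modMvNKernel a d t x) 2) atTop
      (𝓝 0)) :
    Tendsto (fun n => eLpNorm (fun ω => (φ n).integral S ω - fractionalPath a d T t ω) 2 P)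
      atTop (𝓝 0) := by
  refine (tendsto_congr fun n => eLpNorm_congr_ae ?_).1
    ((h.fractionalPath_spec hv hmono hT ha hd t).2 φ h1 h2)
  filter_upwards [integral_ae_eq_of_forall_ae_eq hST (φ n)] with ω hω
  rw [hω]

theorem HasLinearMoments.isFractionalSubordinator (h : HasLinearMoments P T m v) (hv : 0 ≤ v)
    (hmono : ∀ ω, Monotone fun t => T t ω) (hT : Measurable fun p : ℝ × Ω => T p.1 p.2)
    (ha : 0 < a) (hd : d < 0) (hST : ∀ t, S t =ᵐ[P] T t) :
    IsFractionalSubordinator P S a d (fractionalPath a d T) := by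
  intro t
  obtain ⟨φ, h1, h2⟩ := exists_stepFunction_tendsto_modMvNKernel ha hd t
  exact ⟨(h.fractionalPath_spec hv hmono hT ha hd t).1, φ, h1, h2,
    h.tendsto_fractionalPath hv hmono hT ha hd hST t φ h1 h2⟩

theorem HasLinearMoments.ae_eq_fractionalPath (h : HasLinearMoments P T m v) (hv : 0 ≤ v)
    (hmono : ∀ ω, Monotone fun t => T t ω) (hT : Measurable fun p : ℝ × Ω => T p.1 p.2)
    (ha : 0 < a) (hd : d < 0) (hST : ∀ t, S t =ᵐ[P] T t) {X : ℝ → Ω → ℝ}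
    (hX : IsFractionalSubordinator P S a d X) (t : ℝ) : X t =ᵐ[P] fractionalPath a d T t := by
  obtain ⟨hX2, φ, h1, h2, h3⟩ := hX t
  have h4 := h.tendsto_fractionalPath hv hmono hT ha hd hST t φ h1 h2
  have hS : ∀ n, AEStronglyMeasurable ((φ n).integral S) P := fun n =>
    ((memLp_congr_ae (integral_ae_eq_of_forall_ae_eq hST (φ n))).2
      (h.memLp_integral (φ n))).aestronglyMeasurable
  have hY := (h.fractionalPath_spec hv hmono hT ha hd t).1.aestronglyMeasurable
  -- Both variables are `L²` limits of the same elementary integrals.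
  exact tendstoInMeasure_ae_unique
    (tendstoInMeasure_of_tendsto_eLpNorm two_ne_zero hS hX2.aestronglyMeasurable h3)
    (tendstoInMeasure_of_tendsto_eLpNorm two_ne_zero hS hY h4)

end

/-! ### Continuous adapted processes of finite variation -/

section

variable {Ω : Type*} [mΩ : MeasurableSpace Ω] {P : Measure Ω}

theorem isStronglyPredictable_of_continuous {𝓕 : Filtration ℝ≥0 mΩ} {X : ℝ≥0 → Ω → ℝ}
    (hX : StronglyAdapted 𝓕 X) (hc : ∀ ω, Continuous fun t => X t ω) :
    IsStronglyPredictable 𝓕 X := by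
  -- The grid point lies strictly before `t` when `t > 0`, as predictability demands; at `t = 0`
  -- truncated subtraction gives `0`, which is why the set `{⊥}` is treated separately below.
  let grid : ℕ → ℝ≥0 → ℝ≥0 := fun n t => ((⌈(n + 1) * t⌉₊ - 1 : ℕ) : ℝ≥0) / (n + 1)
  have hgrid : ∀ t, Tendsto (fun n => grid n t) atTop (𝓝 t) := by
    intro t
    rw [← NNReal.tendsto_coe]
    have hlb : Tendsto (fun n : ℕ => (t : ℝ) - 1 / ((n : ℝ) + 1)) atTop (𝓝 t) := by
      simpa using tendsto_one_div_add_atTop_nhds_zero_nat.const_sub (t : ℝ)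
    refine tendsto_of_tendsto_of_tendsto_of_le_of_le hlb tendsto_const_nhds
      (fun n => ?_) (fun n => ?_)
    · have hn : (0 : ℝ) < n + 1 := by positivity
      simp only [grid, NNReal.coe_div, NNReal.coe_natCast, NNReal.coe_add, NNReal.coe_one]
      rw [le_div_iff₀ hn, sub_mul, one_div_mul_cancel hn.ne']
      have h1 : (((n : ℝ≥0) + 1) * t : ℝ≥0) ≤ (⌈((n : ℝ≥0) + 1) * t⌉₊ : ℝ≥0) := Nat.le_ceil _
      have h2 : (⌈((n : ℝ≥0) + 1) * t⌉₊ : ℝ≥0) ≤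
          ((⌈((n : ℝ≥0) + 1) * t⌉₊ - 1 : ℕ) : ℝ≥0) + 1 := by
        exact_mod_cast (by omega : ⌈((n : ℝ≥0) + 1) * t⌉₊ ≤ ⌈((n : ℝ≥0) + 1) * t⌉₊ - 1 + 1)
      have h3 : (((n : ℝ) + 1) * t) ≤ ((⌈((n : ℝ≥0) + 1) * t⌉₊ - 1 : ℕ) : ℝ) + 1 := by
        exact_mod_cast h1.trans h2
      linarith
    · have hn : (0 : ℝ) < n + 1 := by positivity
      simp only [grid, NNReal.coe_div, NNReal.coe_natCast, NNReal.coe_add, NNReal.coe_one]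
      rw [div_le_iff₀ hn]
      rcases Nat.eq_zero_or_pos ⌈((n : ℝ≥0) + 1) * t⌉₊ with h0 | h0
      · rw [h0]; simp only [zero_tsub, Nat.cast_zero]; positivity
      · have h1 : (⌈((n : ℝ≥0) + 1) * t⌉₊ : ℝ≥0) < ((n : ℝ≥0) + 1) * t + 1 :=
          Nat.ceil_lt_add_one zero_le
        have h2 : (⌈((n : ℝ≥0) + 1) * t⌉₊ : ℝ) < ((n : ℝ) + 1) * t + 1 := by exact_mod_cast h1
        rw [Nat.cast_sub h0]
        push_cast
        linarith
  let mp : MeasurableSpace (ℝ≥0 × Ω) := 𝓕.predictable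
  refine Measurable.stronglyMeasurable ?_
  refine measurable_of_tendsto_metrizable
    (f := fun n (p : ℝ≥0 × Ω) => X (grid n p.1) p.2) (fun n => ?_)
    (tendsto_pi_nhds.2 fun p => ((hc p.2).tendsto p.1).comp (hgrid p.1))
  intro A hA
  have hk : ∀ k : ℕ, MeasurableSet[𝓕 ((k : ℝ≥0) / (n + 1))] (X ((k : ℝ≥0) / (n + 1)) ⁻¹' A) :=
    fun k => (hX _).measurable hA
  have hset : (fun p : ℝ≥0 × Ω => X (grid n p.1) p.2) ⁻¹' A =
      ({⊥} ×ˢ (X 0 ⁻¹' A)) ∪ ⋃ k : ℕ, Ioc ((k : ℝ≥0) / (n + 1)) (((k + 1 : ℕ) : ℝ≥0) / (n + 1)) ×ˢ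
        (X ((k : ℝ≥0) / (n + 1)) ⁻¹' A) := by
    have hn : (0 : ℝ≥0) < n + 1 := by positivity
    have hmem : ∀ (k : ℕ) (t : ℝ≥0), t ∈ Ioc ((k : ℝ≥0) / (n + 1)) (((k + 1 : ℕ) : ℝ≥0) / (n + 1)) ↔
        ⌈((n : ℝ≥0) + 1) * t⌉₊ = k + 1 := by
      intro k t
      rw [Nat.ceil_eq_iff (Nat.succ_ne_zero k), mem_Ioc, div_lt_iff₀ hn, le_div_iff₀ hn,
        mul_comm t]
      simp
    ext ⟨t, ω⟩
    simp only [mem_preimage, mem_union, mem_prod, mem_singleton_iff, mem_iUnion, hmem]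
    rcases eq_or_ne t 0 with rfl | ht
    · simp [grid]
    · have hpos : 0 < ⌈((n : ℝ≥0) + 1) * t⌉₊ :=
        Nat.ceil_pos.2 (mul_pos hn (pos_iff_ne_zero.2 ht))
      obtain ⟨k, hk'⟩ := Nat.exists_eq_succ_of_ne_zero hpos.ne'
      have hg : grid n t = (k : ℝ≥0) / (n + 1) := by simp [grid, hk']
      rw [hg, hk']
      constructor
      · intro h; exact Or.inr ⟨k, rfl, h⟩
      · rintro (⟨h, -⟩ | ⟨j, hj, h⟩)
        · exact absurd h ht
        · have : k = j := by simpa using hj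
          rwa [this]
  rw [hset]
  refine MeasurableSet.union ?_ (MeasurableSet.iUnion fun k => ?_)
  · exact measurableSet_predictable_singleton_bot_prod ((hX 0).measurable hA)
  · exact measurableSet_predictable_Ioc_prod _ _ (hk k)

theorem isCadlagPath_of_continuous {x : ℝ≥0 → ℝ} (hx : Continuous x) : IsCadlagPath x := fun t =>
  ⟨hx.continuousWithinAt, x t, (hx.tendsto t).mono_left nhdsWithin_le_nhds⟩

theorem pathJump_of_continuous {x : ℝ≥0 → ℝ} (hx : Continuous x) (t : ℝ≥0) : pathJump x t = 0 := by
  rw [pathJump, (hx.continuousWithinAt (s := Iic t)).leftLim_eq, sub_self]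

theorem isLocalMartingaleNull_zero (𝓕 : Filtration ℝ≥0 mΩ) (P : Measure Ω) [IsFiniteMeasure P] :
    IsLocalMartingaleNull 𝓕 P fun _ _ => 0 where
  null _ := rfl
  adapted _ := stronglyMeasurable_const
  cadlag _ := isCadlagPath_of_continuous continuous_const
  locally_martingale := Locally.of_prop (martingale_zero ℝ 𝓕 P)

theorem IsTruncation.apply_zero {h : ℝ → ℝ} (hh : IsTruncation h) : h 0 = 0 :=
  hh.id_near_zero.self_of_nhds

omit mΩ in
theorem largeJumps_of_continuous {h : ℝ → ℝ} (hh : IsTruncation h) {X : ℝ≥0 → Ω → ℝ}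
    (hX : ∀ ω, Continuous fun t => X t ω) (t : ℝ≥0) (ω : Ω) : largeJumps h X t ω = 0 := by
  simp [largeJumps, pathJump_of_continuous (hX ω), hh.apply_zero]

omit mΩ in
theorem jumpMeasure_of_continuous {X : ℝ≥0 → Ω → ℝ} (hX : ∀ ω, Continuous fun t => X t ω) (ω : Ω) :
    jumpMeasure X ω = 0 := by
  have : IsEmpty {s : ℝ≥0 // pathJump (fun r => X r ω) s ≠ 0} :=
    ⟨fun s => s.2 (pathJump_of_continuous (hX ω) s.1)⟩
  rw [jumpMeasure, Measure.sum_of_isEmpty]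

/-- A continuous adapted process `X` of finite variation has characteristics `(X, 0, 0)`. -/
theorem hasCharacteristics_of_continuous [IsFiniteMeasure P] {𝓕 : Filtration ℝ≥0 mΩ}
    {X : ℝ≥0 → Ω → ℝ} (h0 : ∀ ω, X 0 ω = 0) (hX : StronglyAdapted 𝓕 X)
    (hc : ∀ ω, Continuous fun t => X t ω)
    (hv : ∀ ω, LocallyBoundedVariationOn (fun t => X t ω) univ) {h : ℝ → ℝ}
    (hh : IsTruncation h) :
    HasCharacteristics 𝓕 P h X X (fun _ _ => 0) (fun _ => 0) := by
  have hfv : IsFiniteVariationNull 𝓕 X :=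
    ⟨h0, hX, fun ω => isCadlagPath_of_continuous (hc ω), hv⟩
  have hzero := isLocalMartingaleNull_zero 𝓕 P
  exact
  { semimartingale := ⟨hX, fun ω => isCadlagPath_of_continuous (hc ω), fun _ _ => 0, X, hzero, hfv,
      fun t ω => by simp [h0]⟩
    first_predictable := isStronglyPredictable_of_continuous hX hc
    first_finiteVariation := hfv
    first := by simpa [h0, largeJumps_of_continuous hh hc] using hzero
    second_null := fun _ => rfl
    second_adapted := fun _ => stronglyMeasurable_const
    second_continuous := fun _ => continuous_const
    second_monotone := fun _ => monotone_const
    second := ⟨fun _ _ => 0, ⟨hzero, fun _ => continuous_const, fun _ _ => 0, X,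
      ⟨hzero, fun N _ _ => by simpa using hzero⟩, hfv, fun t ω => by simp [h0]⟩,
      by simpa using hzero⟩
    third := ⟨fun ω => by simp, fun W _ => by simp, fun W _ => by
      simp [jumpMeasure_of_continuous hc]⟩ }

/-- The complement is a measurable null set, and these belong to every `𝓕_t`. -/
theorem measurableSet_generatedFiltration_of_ae {S : ℝ → Ω → ℝ} (hS : ∀ t, Measurable (S t))
    {G : Set Ω} (hG : MeasurableSet G) (h : ∀ᵐ ω ∂P, ω ∈ G) (t : ℝ≥0) :
    MeasurableSet[generatedFiltration P S hS t] G := by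
  have hle : MeasurableSpace.generateFrom {N : Set Ω | MeasurableSet N ∧ P N = 0} ≤
      generatedFiltration P S hS t := le_sup_right
  have : MeasurableSet[MeasurableSpace.generateFrom {N : Set Ω | MeasurableSet N ∧ P N = 0}] Gᶜ :=
    MeasurableSpace.measurableSet_generateFrom ⟨hG.compl, ae_iff.1 h⟩
  exact MeasurableSet.compl_iff.1 (hle _ this)

theorem measurable_generatedFiltration {S : ℝ → Ω → ℝ} (hS : ∀ t, Measurable (S t)) {t : ℝ≥0}
    {u : ℝ} (hu : u ≤ t) : Measurable[generatedFiltration P S hS t] (S u) := by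
  have hle : MeasurableSpace.comap (S u) inferInstance ≤ generatedFiltration P S hS t :=
    le_trans (le_iSup (fun u : Iic (t : ℝ) => MeasurableSpace.comap (S u) inferInstance) ⟨u, hu⟩)
      le_sup_left
  exact measurable_iff_comap_le.2 hle

end

/-! ### Growth of subordinators -/

section

variable {Ω : Type*} [MeasurableSpace Ω] {P : Measure Ω} [IsProbabilityMeasure P]
  {S : ℝ → Ω → ℝ} {m v : ℝ}

/-- On the exceptional event `S 0 - S (-(n + 1)) ≤ 0`, a deviation of at least `m (n + 1)` from the
mean. The variance is only `v (n + 1)`, so Chebyshev's bound is of order `1 / (n + 1)`. -/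
theorem HasLinearMoments.ae_exists_lt (h : HasLinearMoments P S m v) (hm : 0 < m) :
    ∀ᵐ ω ∂P, ∃ u, S u ω < S 0 ω := by
  have hi : ∀ t, Integrable (S t) P := fun t => (h.memLp t).integrable (by norm_num)
  have hbound : ∀ n : ℕ, P {ω | ¬ ∃ u, S u ω < S 0 ω} ≤
      ENNReal.ofReal (v / m ^ 2 * (1 / ((n : ℝ) + 1))) := by
    intro n
    have hn : (0 : ℝ) < n + 1 := by positivity
    have hX : MemLp (S 0 - S (-(n + 1))) 2 P := (h.memLp _).sub (h.memLp _)
    have hE : ∫ ω, (S 0 - S (-(n + 1))) ω ∂P = m * (n + 1) := by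
      simp only [Pi.sub_apply]
      rw [integral_sub (hi _) (hi _), h.mean, h.mean]; ring
    have hV : Var[S 0 - S (-(n + 1)); P] = v * (n + 1) := by
      rw [variance_eq_sub hX, hE]
      have e := h.integral_mul (a := -(n + 1)) (b := 0) (a' := -(n + 1)) (b' := 0) (by linarith)
        (by linarith)
      rw [inter_self, Real.volume_Ioc, ENNReal.toReal_ofReal (by linarith)] at e
      simp only [Pi.pow_apply, Pi.sub_apply, sq]
      rw [e]; ring
    have hc := meas_ge_le_variance_div_sq hX (mul_pos hm hn)
    rw [hE, hV] at hc
    refine (measure_mono fun ω hω => ?_).trans (hc.trans (ENNReal.ofReal_le_ofReal (le_of_eq ?_)))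
    · have h1 : S 0 ω ≤ S (-(n + 1)) ω := not_lt.1 fun hlt => hω ⟨_, hlt⟩
      simp only [mem_ofPred_eq, Pi.sub_apply]
      rw [abs_of_nonpos (by nlinarith)]
      linarith
    · field_simp
  have hlim : Tendsto (fun n : ℕ => ENNReal.ofReal (v / m ^ 2 * (1 / ((n : ℝ) + 1)))) atTop
      (𝓝 0) := by
    have := ENNReal.tendsto_ofReal
      ((tendsto_one_div_add_atTop_nhds_zero_nat (𝕜 := ℝ)).const_mul (v / m ^ 2))
    simpa using this
  exact ae_iff.2 (le_antisymm (ge_of_tendsto' hlim hbound) zero_le)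

omit [IsProbabilityMeasure P] in
theorem IsTwoSidedSubordinator.ae_nonneg (hS : IsTwoSidedSubordinator P S) {t : ℝ} (ht : 0 ≤ t) :
    ∀ᵐ ω ∂P, 0 ≤ S t ω := by
  obtain ⟨L₁, L₂, h₁, h₂, -, -, hpath⟩ := hS.exists_copies
  filter_upwards [hpath, h₂.ae_nonneg] with ω h n₂
  rw [h t, if_neg (not_lt.2 ht)]
  exact n₂ _

/-- If `X` vanished, the Laplace exponent at `l = 1` would be zero. It is a sum of two nonnegative
terms, so both the drift and the mass of `ν` on `(0, ∞)` would be zero. -/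
theorem IsSubordinatorTriple.not_ae_eq_zero {X : Ω → ℝ} (hX : Measurable X) {γ : ℝ} {ν : Measure ℝ}
    (h : IsSubordinatorTriple (P.map X) γ ν) (hγν : 0 < γ ∨ ν (Ioi 0) = ∞) : ¬ X =ᵐ[P] 0 := by
  intro hX0
  have hpos : ∀ᵐ x ∂ν, 0 < x := by
    rw [ae_iff]
    simp only [not_lt]
    exact h.carried
  have hle : ∀ x : ℝ, 0 < x → 0 < 1 - Real.exp (-(1 * x)) := by
    intro x hx
    have : Real.exp (-(1 * x)) < 1 := Real.exp_lt_one_iff.2 (by linarith)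
    linarith
  -- The Bochner integral of a non-integrable function is `0` by default, so integrability is needed
  -- before a zero integral says anything about `ν`; it follows from `1 - e^{-x} ≤ min 1 x`.
  have hint : Integrable (fun x => 1 - Real.exp (-(1 * x))) ν := by
    have hm : Measurable fun x : ℝ => 1 - Real.exp (-(1 * x)) := by fun_prop
    refine ⟨hm.aestronglyMeasurable, ?_⟩
    rw [hasFiniteIntegral_iff_ofReal (hpos.mono fun x hx => (hle x hx).le)]
    refine lt_of_le_of_lt (lintegral_mono fun x => ENNReal.ofReal_le_ofReal ?_) h.integrable_min
    refine le_min (by linarith [Real.exp_pos (-(1 * x))]) ?_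
    linarith [Real.add_one_le_exp (-(1 * x))]
  have hnn : 0 ≤ᵐ[ν] fun x => 1 - Real.exp (-(1 * x)) := hpos.mono fun x hx => (hle x hx).le
  have hl := h.laplace 1 zero_le_one
  rw [integral_map hX.aemeasurable (by fun_prop)] at hl
  have e : ∫ ω, Real.exp (-(1 * X ω)) ∂P = 1 := by
    rw [integral_congr_ae (g := fun _ => 1) (hX0.mono fun ω hω => by simp [hω])]
    simp
  rw [e, eq_comm, Real.exp_eq_one_iff] at hl
  have hI : 0 ≤ ∫ x, (1 - Real.exp (-(1 * x))) ∂ν := integral_nonneg_of_ae hnn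
  rcases hγν with hγ | hν
  · linarith
  · have hz : ∫ x, (1 - Real.exp (-(1 * x))) ∂ν = 0 := by linarith [h.drift_nonneg]
    have := (integral_eq_zero_iff_of_nonneg_ae hnn hint).1 hz
    have hF : ∀ᵐ x ∂ν, x ∉ Ioi 0 := by
      filter_upwards [hpos, this] with x hx hx'
      exact absurd hx' (hle x hx).ne'
    have : ν (Ioi 0) = 0 := measure_eq_zero_iff_ae_notMem.2 hF
    rw [this] at hν
    exact ENNReal.zero_ne_top hν

theorem IsTwoSidedSubordinator.ae_exists_lt (hS : IsTwoSidedSubordinator P S)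
    (hS2 : MemLp (S 1) 2 P)
    (h : (∀ᵐ ω ∂P, StrictMono fun t => S t ω) ∨
      ∃ (γ : ℝ) (ν : Measure ℝ), IsSubordinatorTriple (P.map (S 1)) γ ν ∧
        (0 < γ ∨ ν (Ioi 0) = ∞)) :
    ∀ᵐ ω ∂P, ∃ u, S u ω < S 0 ω := by
  rcases h with h | ⟨γ, ν, h, hγν⟩
  · exact h.mono fun ω hω => ⟨-1, hω (by norm_num)⟩
  · refine (hS.hasLinearMoments hS2).ae_exists_lt ?_
    have hnn : 0 ≤ᵐ[P] S 1 := hS.ae_nonneg zero_le_one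
    refine lt_of_le_of_ne (integral_nonneg_of_ae hnn) fun h0 => ?_
    exact h.not_ae_eq_zero (hS.measurable 1) hγν
      ((integral_eq_zero_iff_of_nonneg_ae hnn (hS2.integrable (by norm_num))).1 h0.symm)

end

end

/-! ### The main theorem -/

theorem mainTheorem3 {Ω : Type*} [MeasurableSpace Ω] (P : Measure Ω) [IsProbabilityMeasure P]
    (S : ℝ → Ω → ℝ) (hS : IsTwoSidedSubordinator P S) (hS2 : MemLp (S 1) 2 P)
    (a d : ℝ) (ha : 0 < a) (hd : d ∈ Ioo (-(1 / 2) : ℝ) 0) :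
    -- there is a version `Y` of `S^{a,d}`, and every version is a modification of it
    ∃ Y : ℝ → Ω → ℝ, IsFractionalSubordinator P S a d Y ∧
      (∀ X : ℝ → Ω → ℝ, IsFractionalSubordinator P S a d X → ∀ t, X t =ᵐ[P] Y t) ∧
      -- (i) continuous paths of finite variation
      (∀ᵐ ω ∂P, ContinuousOn (fun t => Y t ω) (Ici 0) ∧
        LocallyBoundedVariationOn (fun t => Y t ω) (Ici 0)) ∧
      -- (ii) semimartingale with characteristics `(S^{a,d}, 0, 0)`
      (∀ h : ℝ → ℝ, IsTruncation h →
        HasCharacteristics (generatedFiltration P S hS.measurable) P h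
          (fun (t : ℝ≥0) ω => Y t ω) (fun (t : ℝ≥0) ω => Y t ω) (fun _ _ => 0) (fun _ => 0)) ∧
      -- (iii) strictly increasing paths
      (((∀ᵐ ω ∂P, StrictMono fun t => S t ω) ∨
          ∃ (γ : ℝ) (ν : Measure ℝ), IsSubordinatorTriple (P.map (S 1)) γ ν ∧
            (0 < γ ∨ ν (Ioi 0) = ∞)) →
        ∀ᵐ ω ∂P, StrictMonoOn (fun t => Y t ω) (Ici 0)) := by
  obtain ⟨G, hGsub, hG, hGP⟩ : ∃ G ⊆ {ω | Monotone (fun t => S t ω) ∧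
      ∀ t, ContinuousWithinAt (fun s => S s ω) (Ici t) t},
      MeasurableSet G ∧ ∀ᵐ ω ∂P, ω ∈ G := by
    obtain ⟨G, hGae, hG, hGsub⟩ := hS.ae_path.exists_measurable_mem
    exact ⟨G, fun ω hω => hGsub ω hω, hG, hGae⟩
  -- Off `G` the path is replaced by zero, so that monotonicity and right-continuity hold for every
  -- `ω`. Since `G` has full measure, it lies in every `𝓕_t` and `T` remains adapted.
  let T : ℝ → Ω → ℝ := fun t => G.indicator (S t)
  have hmono : ∀ ω, Monotone fun t => T t ω := by
    intro ω
    by_cases hω : ω ∈ G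
    · simpa only [T, indicator_of_mem hω] using (hGsub hω).1
    · simpa only [T, indicator_of_notMem hω] using monotone_const
  have hright : ∀ ω t, ContinuousWithinAt (fun s => T s ω) (Ici t) t := by
    intro ω t
    by_cases hω : ω ∈ G
    · simpa only [T, indicator_of_mem hω] using (hGsub hω).2 t
    · simpa only [T, indicator_of_notMem hω] using continuousWithinAt_const
  have hTm : ∀ t, Measurable (T t) := fun t => (hS.measurable t).indicator hG
  have hT := measurable_uncurry_of_rightContinuous hTm hright
  have hST : ∀ t, S t =ᵐ[P] T t := fun t => hGP.mono fun ω hω => (indicator_of_mem hω (S t)).symm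
  have hlin := (hS.hasLinearMoments hS2).congr hST
  have hv : 0 ≤ Var[S 1; P] := variance_nonneg _ _
  have hd0 : d < 0 := hd.2
  have hcont := continuous_fractionalPath (a := a) (d := d) hmono
  have hmonoY := monotone_fractionalPath (a := a) (d := d) hmono
  have hfin := hlin.ae_mem_finiteDensitySet hv hmono hT ha hd0
  refine ⟨fractionalPath a d T, hlin.isFractionalSubordinator hv hmono hT ha hd0 hST,
    fun X hX t => hlin.ae_eq_fractionalPath hv hmono hT ha hd0 hST hX t,
    ae_of_all _ fun ω => ⟨(hcont ω).continuousOn,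
      ((hmonoY ω).monotoneOn _).locallyBoundedVariationOn⟩,
    fun h hh => ?_, fun hinc => ?_⟩
  · refine hasCharacteristics_of_continuous (fun ω => fractionalPath_zero ω) (fun t => ?_)
      (fun ω => (hcont ω).comp NNReal.continuous_coe) (fun ω => ?_) hh
    · refine (measurable_fractionalPath_of_le (m := generatedFiltration P S hS.measurable t)
        hmono hright t.2 (fun u hu => ?_) ?_).stronglyMeasurable
      · exact (measurable_generatedFiltration hS.measurable hu).indicator
          (measurableSet_generatedFiltration_of_ae hS.measurable hG hGP t)
      · exact measurableSet_generatedFiltration_of_ae hS.measurable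
          (measurableSet_finiteDensitySet hT) hfin t
    · exact (((hmonoY ω).comp NNReal.coe_mono).monotoneOn _).locallyBoundedVariationOn
  · filter_upwards [hS.ae_exists_lt hS2 hinc, hfin, hGP] with ω ⟨u, hu⟩ hω hωG
    refine strictMonoOn_fractionalPath ha hd0 hmono hω (u := u) ?_
    simpa only [T, indicator_of_mem hωG] using hu
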